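/- Let $R$ be a nontrivial commutative semiring (for instance a finite field, or $\mathbb N$). For integers $0\le i<j$ let $x_{ij}$ be a variable. For a set $S$ of $k$ natural numbers, the $k$-clique monomial with respect to $S$ is the multilinear monomial $\prod_{i,j\in S,\ i<j}x_{ij}$, of degree $k(k-1)/2$. An arithmetic circuit is a directed acyclic graph with one output, with $+$ gates of unbounded (nonzero) fan-in and $\times$ gates of fan-in two, and whose terminals are variables $x_{ij}$; it represents a polynomial over $R$. Consider the following parameterized problem, with parameter $k$: given $k$ and an arithmetic circuit that represents a (nonzero) polynomial of degree $k(k-1)/2$ over $R$, decide whether this polynomial has a $k$-clique monomial, with respect to some $k$-element set $S$, in its sum-product expansion (that is, with nonzero coefficient). **Theorem.** This problem is $\mathrm{W}[1]$-hard: every parameterized problem $A$ in $\mathrm{W}[1]$ has a parameterized reduction to it, i.e. there are computable functions $f,g$, a constant $c$ and an algorithm that maps each instance $(x,k)$ of $A$, in at most $f(k)\cdot|x|^{c}$ steps, to an instance $(x',k')$ of the above problem with the same answer and with $k'\le g(k)$. In particular, each $(x',k')$ does satisfy the degree condition. Here $\mathrm{W}[1]$ is the class of the parameterized problems that, for some constant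 $d$, have a parameterized reduction to the following problem with parameter $k$: given $k$ and a Boolean circuit of depth at most $d$ and weft at most $1$ (every path from an input to the output contains at most one gate of fan-in greater than two), decide whether some assignment that sets exactly $k$ inputs to true satisfies the circuit. -/

import Mathlib

namespace ParamComplexity

/-! ### A machine model with a step count

Programs of a small `while` language over binary trees (S-expressions). Every primitive is
charged the size of the data it handles, so the size of a result never exceeds the cost of
computing it, and the model is polynomially equivalent to Turing machines. -/

/-- Binary trees, the only data type of the model. -/
inductive Data : Type where
  | nil : Data
  | cons : Data → Data → Data

namespace Data

/-- Number of nodes. -/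
def size : Data → ℕ
  | nil => 1
  | cons a b => a.size + b.size + 1

/-- Left subtree (`nil` for the empty tree). -/
def hd : Data → Data
  | nil => nil
  | cons a _ => a

/-- Right subtree (`nil` for the empty tree). -/
def tl : Data → Data
  | nil => nil
  | cons _ b => b

/-- Unary representation of a natural number. -/
def num : ℕ → Data
  | 0 => nil
  | n + 1 => cons nil (num n)

/-- Representation of a list of trees. -/
def list : List Data → Data
  | [] => nil
  | a :: l => cons a (list l)

end Data

/-- Programs; each of them transforms one tree into another. -/
inductive Prog : Type where
  | id : Prog
  | nil : Prog
  | hd : Prog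
  | tl : Prog
  /-- run both programs on the input and pair the results -/
  | cons : Prog → Prog → Prog
  /-- `comp p q`: run `q`, then `p` on its result -/
  | comp : Prog → Prog → Prog
  /-- `ite c p q`: run `p` if the result of `c` is not `nil`, and `q` otherwise -/
  | ite : Prog → Prog → Prog → Prog
  /-- `loop c p`: as long as the result of `c` is not `nil`, apply `p` -/
  | loop : Prog → Prog → Prog

/-- `Runs p x y t`: on input `x` the program `p` halts with output `y` after `t` steps. -/
inductive Runs : Prog → Data → Data → ℕ → Prop where
  | id (x : Data) : Runs .id x x x.size
  | nil (x : Data) : Runs .nil x .nil 1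
  | hd (x : Data) : Runs .hd x x.hd x.size
  | tl (x : Data) : Runs .tl x x.tl x.size
  | cons {p q : Prog} {x a b : Data} {s t : ℕ} :
      Runs p x a s → Runs q x b t → Runs (.cons p q) x (.cons a b) (s + t + 1)
  | comp {p q : Prog} {x y z : Data} {s t : ℕ} :
      Runs q x y s → Runs p y z t → Runs (.comp p q) x z (s + t + 1)
  | ite_true {c p q : Prog} {x v y : Data} {s t : ℕ} :
      Runs c x v s → v ≠ .nil → Runs p x y t → Runs (.ite c p q) x y (s + t + 1)
  | ite_false {c p q : Prog} {x y : Data} {s t : ℕ} :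
      Runs c x .nil s → Runs q x y t → Runs (.ite c p q) x y (s + t + 1)
  | loop_done {c p : Prog} {x : Data} {s : ℕ} :
      Runs c x .nil s → Runs (.loop c p) x x (s + x.size)
  | loop_step {c p : Prog} {x v y z : Data} {s t u : ℕ} :
      Runs c x v s → v ≠ .nil → Runs p x y t → Runs (.loop c p) y z u →
      Runs (.loop c p) x z (s + t + u + 1)

/-! ### Parameterized problems and fpt-reductions -/

/-- A parameterized problem: a set of instances `(x, k)`, `k` being the parameter, and the
yes-instances among them. For a parameterized language `inst` is everything. -/
structure ParamProblem where
  inst : Set (Data × ℕ)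
  yes : Set (Data × ℕ)

/-- Parameterized (many-one) reducibility: instances `(x, k)` of `A` are mapped to instances
`(x', k')` of `B` with the same answer, in time `f(k) · |x|^c`, and with `k' ≤ g(k)`, where `f`
and `g` are computable. -/
def FPTReduces (A B : ParamProblem) : Prop :=
  ∃ (p : Prog) (f g : ℕ → ℕ) (c : ℕ), Computable f ∧ Computable g ∧
    ∀ (x : Data) (k : ℕ), (x, k) ∈ A.inst →
      ∃ (x' : Data) (k' t : ℕ),
        Runs p (.cons x (.num k)) (.cons x' (.num k')) t ∧
        t ≤ f k * x.size ^ c ∧ k' ≤ g k ∧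
        (x', k') ∈ B.inst ∧ ((x, k) ∈ A.yes ↔ (x', k') ∈ B.yes)

/-! ### Circuits as lists of gates

A circuit (a directed acyclic graph) is a list of gates in topological order: a gate names its
predecessors by their positions in the list. The last gate is the output. -/

/-- Compute a value for every gate, `step v g` being the value of the gate `g` that comes after
gates with values `v`. -/
def gateTable {G α : Type*} (step : List α → G → α) (C : List G) : List α :=
  C.foldl (fun v g => v ++ [step v g]) []

/-! ### Boolean circuits, weft, and the class W[1] -/

inductive BoolGate : Type where
  | input : BoolGate
  | neg : ℕ → BoolGate
  | conj : List ℕ → BoolGate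
  | disj : List ℕ → BoolGate

namespace BoolGate

def args : BoolGate → List ℕ
  | input => []
  | neg a => [a]
  | conj l => l
  | disj l => l

/-- Every gate other than an input has at least one predecessor. -/
def Proper : BoolGate → Prop
  | input => True
  | g => g.args ≠ []

def encode : BoolGate → Data
  | input => .cons (.num 0) .nil
  | neg a => .cons (.num 1) (.num a)
  | conj l => .cons (.num 2) (.list (l.map .num))
  | disj l => .cons (.num 3) (.list (l.map .num))

/-- Truth value of a gate when exactly the input gates at the positions in `T` are true. -/
def value (T : Finset ℕ) (v : List Bool) : BoolGate → Bool
  | input => decide (v.length ∈ T)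
  | neg a => !(v.getD a false)
  | conj l => l.all fun a => v.getD a false
  | disj l => l.any fun a => v.getD a false

/-- Largest number of non-input gates on a path from an input to this gate. -/
def depth (v : List ℕ) : BoolGate → ℕ
  | input => 0
  | g => (g.args.map fun a => v.getD a 0).foldr max 0 + 1

/-- Largest number of large gates (gates of fan-in greater than two) on a path from an input to
this gate. -/
def weft (v : List ℕ) (g : BoolGate) : ℕ :=
  (g.args.map fun a => v.getD a 0).foldr max 0 + if 2 < g.args.length then 1 else 0

end BoolGate

abbrev BoolCircuit : Type := List BoolGate

namespace BoolCircuit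

structure WellFormed (C : BoolCircuit) : Prop where
  nonempty : C ≠ []
  proper : ∀ g ∈ C, g.Proper
  acyclic : ∀ (t : ℕ) (ht : t < C.length), ∀ a ∈ (C[t]).args, a < t

def encode (C : BoolCircuit) : Data := .list (C.map BoolGate.encode)

def eval (C : BoolCircuit) (T : Finset ℕ) : Bool :=
  (gateTable (BoolGate.value T) C).getLastD false

def depth (C : BoolCircuit) : ℕ := (gateTable BoolGate.depth C).getLastD 0

def weft (C : BoolCircuit) : ℕ := (gateTable BoolGate.weft C).getLastD 0

/-- Some assignment that makes exactly `k` inputs true satisfies the circuit. -/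
def WeightedSat (C : BoolCircuit) (k : ℕ) : Prop :=
  ∃ T : Finset ℕ, (∀ t ∈ T, C[t]? = some .input) ∧ T.card = k ∧ C.eval T = true

end BoolCircuit

/-- Weighted satisfiability of Boolean circuits of weft at most `w` and depth at most `d`,
parameterized by the weight. -/
def weightedCircuitSat (w d : ℕ) : ParamProblem where
  inst := {I | ∃ C : BoolCircuit, C.WellFormed ∧ C.weft ≤ w ∧ C.depth ≤ d ∧ I.1 = C.encode}
  yes := {I | ∃ C : BoolCircuit, C.WellFormed ∧ C.weft ≤ w ∧ C.depth ≤ d ∧ I.1 = C.encode ∧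
    C.WeightedSat I.2}

/-- The class W[w]: the problems that reduce to weighted satisfiability of circuits of weft at
most `w` and depth at most `d`, for some constant `d`. -/
def W (w : ℕ) : Set ParamProblem := {A | ∃ d : ℕ, FPTReduces A (weightedCircuitSat w d)}

/-- Hardness for W[1] under parameterized reductions. -/
def W1Hard (B : ParamProblem) : Prop := ∀ A ∈ W 1, FPTReduces A B

/-! ### Arithmetic circuits and clique monomials -/

/-- Gates of arithmetic circuits: the variable `x_{ij}`, an addition gate of unbounded fan-in,
a multiplication gate of fan-in two. -/
inductive ArithGate : Type where
  | var : ℕ → ℕ → ArithGate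
  | add : List ℕ → ArithGate
  | mul : ℕ → ℕ → ArithGate

namespace ArithGate

def args : ArithGate → List ℕ
  | var _ _ => []
  | add l => l
  | mul a b => [a, b]

/-- The edge variables are `x_{ij}` with `i < j`; addition gates have a predecessor. -/
def Proper : ArithGate → Prop
  | var i j => i < j
  | add l => l ≠ []
  | mul _ _ => True

def encode : ArithGate → Data
  | var i j => .cons (.num 0) (.cons (.num i) (.num j))
  | add l => .cons (.num 1) (.list (l.map .num))
  | mul a b => .cons (.num 2) (.cons (.num a) (.num b))

/-- The polynomial computed by a gate. -/
noncomputable def value (R : Type*) [CommSemiring R] (v : List (MvPolynomial (ℕ × ℕ) R)) :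
    ArithGate → MvPolynomial (ℕ × ℕ) R
  | var i j => MvPolynomial.X (i, j)
  | add l => (l.map fun a => v.getD a 0).sum
  | mul a b => v.getD a 0 * v.getD b 0

end ArithGate

abbrev ArithCircuit : Type := List ArithGate

namespace ArithCircuit

structure WellFormed (C : ArithCircuit) : Prop where
  nonempty : C ≠ []
  proper : ∀ g ∈ C, g.Proper
  acyclic : ∀ (t : ℕ) (ht : t < C.length), ∀ a ∈ (C[t]).args, a < t

def encode (C : ArithCircuit) : Data := .list (C.map ArithGate.encode)

/-- The polynomial represented by the circuit. -/
noncomputable def poly (R : Type*) [CommSemiring R] (C : ArithCircuit) :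
    MvPolynomial (ℕ × ℕ) R :=
  (gateTable (ArithGate.value R) C).getLastD 0

end ArithCircuit

/-- The exponent vector of the clique monomial `∏ x_{ij}`, over all `i < j` in `S`. -/
noncomputable def cliqueMonomial (S : Finset ℕ) : (ℕ × ℕ) →₀ ℕ :=
  ∑ e ∈ (S ×ˢ S).filter (fun e => e.1 < e.2), Finsupp.single e 1

/-- `P` has a `k`-clique monomial in its sum-product expansion. -/
def HasCliqueMonomial {R : Type*} [CommSemiring R] (P : MvPolynomial (ℕ × ℕ) R) (k : ℕ) : Prop :=
  ∃ S : Finset ℕ, S.card = k ∧ P.coeff (cliqueMonomial S) ≠ 0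

/-- `C` represents a (nonzero) polynomial of degree `k(k-1)/2`. -/
def RepresentsCliqueDegree (R : Type*) [CommSemiring R] (C : ArithCircuit) (k : ℕ) : Prop :=
  C.WellFormed ∧ C.poly R ≠ 0 ∧ (C.poly R).totalDegree = k * (k - 1) / 2

/-- Given an arithmetic circuit that represents a polynomial of degree `k(k-1)/2` over `R`, test
whether the polynomial has a `k`-clique monomial; the parameter is `k`. -/
def cliqueMonomialTesting (R : Type*) [CommSemiring R] : ParamProblem where
  inst := {I | ∃ C : ArithCircuit, RepresentsCliqueDegree R C I.2 ∧ I.1 = C.encode}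
  yes := {I | ∃ C : ArithCircuit, RepresentsCliqueDegree R C I.2 ∧ I.1 = C.encode ∧
    HasCliqueMonomial (C.poly R) I.2}

end ParamComplexity

namespace ParamComplexity

/-! ### Running times of programs -/

namespace Data

/-! Composition of reductions leaves weighted satisfiability of circuits of weft one and depth at
most `d`. Such a circuit becomes an instance of a multicoloured clique problem, which is then
written as a product of linear forms.

Normal form. As `d` is constant, expanding the small gates by De Morgan's laws turns the output into
a disjunction of polynomially many alternatives, each a conjunction of prescribed gate values
(`exists_alts`). A path meets at most one large gate, so the prescribed gates have weft zero and
depend on at most `2 ^ d ≤ q` inputs (`weftAt_of_mem_alts`, `length_support_le`).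

Compatible choices. A solution is an injective map `t` from the indices below `k` to inputs. Two
further indices have dummy values; one serves for padding, and both together keep the number of
lists large even for `k = 0`. There is one list for each `q`-tuple `I` of indices. An entry names an
alternative, the values of `t` on `I`, and a hitting set. The hitting set is there because an
alternative may prescribe unboundedly many gates: a gate that is wrong on the inputs given by `I`
alone can only be repaired by a further true input in its support, and the entry has to name such
inputs for all wrong gates at once. The graph of `t` has `k + 2` elements and hits all these
supports, so a bounded search tree finds a hitting set inside it (`exists_hittingSet`). Conversely,
suppose that a gate is wrong under the whole assignment. The tuple of those indices whose inputs lie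
in its support sees the same wrong value, and the hitting set then yields a true input of the
support outside the tuple, a contradiction (`hasCompatChoice_iff`).

Polynomial. For `K` lists, the factor for `α < β` is the sum of the variables for compatible pairs
of entries, plus `x_{01}`. The product is homogeneous of degree `K(K-1)/2`, and `x_{01}` keeps it
nonzero. For `K ≥ 3` a clique monomial cannot contain `x_{01}`, so it selects one entry from each
list, pairwise compatible. Only one choice of terms produces such a monomial, so its coefficient is
one over every nontrivial `R` (`hasCliqueMonomial_choiceCircuit_iff`).

Running time. Closure properties of `Poly` show that everything is polynomial in the circuit, `k`
and a cut-off `N` for the search tree, and `N` depends on `k` only (`exists_runs_reduction`). -/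

theorem one_le_size (x : Data) : 1 ≤ x.size := by
  cases x <;> simp [size]

theorem size_hd_le (x : Data) : x.hd.size ≤ x.size := by
  cases x <;> simp [size, hd]; omega

theorem size_tl_le (x : Data) : x.tl.size ≤ x.size := by
  cases x <;> simp [size, tl]; omega

theorem num_injective : Function.Injective num := by
  intro m
  induction m with
  | zero => intro n h; cases n <;> simp_all [num]
  | succ m ih =>
    intro n h
    cases n with
    | zero => simp [num] at h
    | succ n => simp only [num, cons.injEq, true_and] at h; rw [ih h]

theorem list_injective : Function.Injective list := by
  intro l
  induction l with
  | nil => intro l' h; cases l' <;> simp_all [list]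
  | cons a l ih =>
    intro l' h
    cases l' with
    | nil => simp [list] at h
    | cons b l' =>
      simp only [list, cons.injEq] at h
      rw [h.1, ih h.2]

end Data

/-- The output of a program is no larger than its running time. -/
theorem Runs.size_le {p : Prog} {x y : Data} {t : ℕ} (h : Runs p x y t) : y.size ≤ t := by
  induction h with
  | id x => exact le_rfl
  | nil x => simp [Data.size]
  | hd x => exact x.size_hd_le
  | tl x => exact x.size_tl_le
  | cons _ _ h₁ h₂ => simp only [Data.size]; omega
  | comp => omega
  | ite_true => omega
  | ite_false => omega
  | loop_done => omega
  | loop_step => omega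

/-- A program with a given constant output. -/
def Prog.const : Data → Prog
  | .nil => .nil
  | .cons a b => .cons (Prog.const a) (Prog.const b)

theorem Runs.const (d x : Data) : Runs (Prog.const d) x d d.size := by
  induction d with
  | nil => exact Runs.nil x
  | cons a b ha hb => exact Runs.cons ha hb

/-! ### Encodings -/

/-- A representation of the elements of a type by trees. -/
class Enc (α : Type*) where
  enc : α → Data

open Enc

instance : Enc ℕ := ⟨Data.num⟩
instance : Enc Unit := ⟨fun _ => Data.nil⟩
instance : Enc Bool := ⟨fun b => if b then .cons .nil .nil else .nil⟩
instance {α β : Type*} [Enc α] [Enc β] : Enc (α × β) := ⟨fun p => .cons (enc p.1) (enc p.2)⟩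
instance {α : Type*} [Enc α] : Enc (List α) := ⟨fun l => .list (l.map enc)⟩
instance : Enc BoolGate := ⟨BoolGate.encode⟩
instance : Enc ArithGate := ⟨ArithGate.encode⟩

/-- The size of the representation. -/
def sz {α : Type*} [Enc α] (a : α) : ℕ := (enc a).size

section

variable {α β γ δ σ : Type*} [Enc α] [Enc β] [Enc γ] [Enc δ] [Enc σ]

theorem one_le_sz (a : α) : 1 ≤ sz a := Data.one_le_size _

@[simp] theorem sz_prod (p : α × β) : sz p = sz p.1 + sz p.2 + 1 := rfl
@[simp] theorem sz_nil : sz ([] : List α) = 1 := rfl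
@[simp] theorem sz_cons (a : α) (l : List α) : sz (a :: l) = sz a + sz l + 1 := rfl
@[simp] theorem sz_unit (u : Unit) : sz u = 1 := rfl

@[simp] theorem sz_nat (n : ℕ) : sz n = 2 * n + 1 := by
  induction n with
  | zero => rfl
  | succ n ih =>
    have : sz (n + 1) = 1 + sz n + 1 := rfl
    rw [this, ih]; ring

@[simp] theorem sz_append (l l' : List α) : sz (l ++ l') + 1 = sz l + sz l' := by
  induction l with
  | nil => simp; ring
  | cons a l ih => simp only [List.cons_append, sz_cons]; omega

theorem sz_reverse (l : List α) : sz l.reverse = sz l := by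
  induction l with
  | nil => rfl
  | cons a l ih =>
    have := sz_append l.reverse [a]
    simp only [List.reverse_cons, sz_cons, sz_nil] at *
    omega

theorem length_lt_sz (l : List α) : l.length < sz l := by
  induction l with
  | nil => simp
  | cons a l ih => simp only [List.length_cons, sz_cons]; omega

theorem sz_le_of_mem {a : α} {l : List α} (h : a ∈ l) : sz a ≤ sz l := by
  induction l with
  | nil => simp at h
  | cons b l ih =>
    rcases List.mem_cons.1 h with rfl | h
    · simp only [sz_cons]; omega
    · have := ih h; simp only [sz_cons]; omega

/-- A list of at most `n` elements of size at most `m`. -/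
theorem sz_list_le {l : List α} {n m : ℕ} (hn : l.length ≤ n) (hm : ∀ a ∈ l, sz a ≤ m) :
    sz l ≤ n * (m + 1) + 1 := by
  have : sz l ≤ l.length * (m + 1) + 1 := by
    clear hn
    induction l with
    | nil => simp
    | cons a l ih =>
      have h₁ := hm a (by simp)
      have h₂ := ih fun b hb => hm b (by simp [hb])
      simp only [sz_cons, List.length_cons]
      nlinarith
  exact this.trans (by gcongr)

/-- The coefficients are natural numbers. Monotonicity allows time bounds to be evaluated at upper
bounds of sizes. -/
theorem eval_mono (P : Polynomial ℕ) {m n : ℕ} (h : m ≤ n) : P.eval m ≤ P.eval n := by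
  rw [Polynomial.eval_eq_sum_range, Polynomial.eval_eq_sum_range]
  exact Finset.sum_le_sum fun i _ => by gcongr

/-! ### Polynomial time computable functions -/

/-- `f` is computed by a program in time polynomial in the size of the input. -/
def Poly (f : α → β) : Prop :=
  ∃ (p : Prog) (P : Polynomial ℕ), ∀ a, ∃ t, Runs p (enc a) (enc (f a)) t ∧ t ≤ P.eval (sz a)

namespace Poly

theorem exists_sz_le {f : α → β} (hf : Poly f) :
    ∃ P : Polynomial ℕ, ∀ a, sz (f a) ≤ P.eval (sz a) := by
  obtain ⟨p, P, h⟩ := hf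
  refine ⟨P, fun a => ?_⟩
  obtain ⟨t, ht, hle⟩ := h a
  exact ht.size_le.trans hle

theorem of_enc_eq {f : α → β} (h : ∀ a, enc (f a) = enc a) : Poly f :=
  ⟨.id, .X, fun a => ⟨_, by rw [h]; exact Runs.id _, by simp [sz]⟩⟩

theorem id : Poly (fun a : α => a) := of_enc_eq fun _ => rfl

theorem const (b : β) : Poly (fun _ : α => b) :=
  ⟨.const (enc b), Polynomial.C (sz b), fun _ => ⟨_, Runs.const _ _, by simp [sz]⟩⟩

theorem comp {f : β → δ} {g : α → β} (hf : Poly f) (hg : Poly g) : Poly (fun a => f (g a)) := by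
  obtain ⟨p, P, hp⟩ := hf
  obtain ⟨q, Q, hq⟩ := hg
  refine ⟨.comp p q, Q + P.comp Q + 1, fun a => ?_⟩
  obtain ⟨t, ht, hle⟩ := hq a
  obtain ⟨s, hs, hle'⟩ := hp (g a)
  refine ⟨_, Runs.comp ht hs, ?_⟩
  have : P.eval (sz (g a)) ≤ P.eval (Q.eval (sz a)) := eval_mono P (ht.size_le.trans hle)
  simp only [Polynomial.eval_add, Polynomial.eval_comp, Polynomial.eval_one]
  omega

theorem pair {f : α → β} {g : α → δ} (hf : Poly f) (hg : Poly g) : Poly (fun a => (f a, g a)) := by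
  obtain ⟨p, P, hp⟩ := hf
  obtain ⟨q, Q, hq⟩ := hg
  refine ⟨.cons p q, P + Q + 1, fun a => ?_⟩
  obtain ⟨t, ht, hle⟩ := hp a
  obtain ⟨s, hs, hle'⟩ := hq a
  refine ⟨_, Runs.cons ht hs, ?_⟩
  simp only [Polynomial.eval_add, Polynomial.eval_one]
  omega

theorem of_hd {f : α → β} (h : ∀ a, (enc a).hd = enc (f a)) : Poly f :=
  ⟨.hd, .X, fun a => ⟨_, by rw [← h]; exact Runs.hd _, by simp [sz]⟩⟩

theorem of_tl {f : α → β} (h : ∀ a, (enc a).tl = enc (f a)) : Poly f :=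
  ⟨.tl, .X, fun a => ⟨_, by rw [← h]; exact Runs.tl _, by simp [sz]⟩⟩

theorem fst : Poly (fun p : α × β => p.1) := of_hd fun _ => rfl
theorem snd : Poly (fun p : α × β => p.2) := of_tl fun _ => rfl

/-- Branching on whether the value of `c` is represented by the empty tree. -/
theorem ite_enc {c : α → δ} {P : α → Prop} [DecidablePred P] {f g : α → β} (hc : Poly c)
    (hP : ∀ a, P a ↔ enc (c a) ≠ .nil) (hf : Poly f) (hg : Poly g) :
    Poly (fun a => if P a then f a else g a) := by
  obtain ⟨r, S, hr⟩ := hc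
  obtain ⟨p, P, hp⟩ := hf
  obtain ⟨q, Q, hq⟩ := hg
  refine ⟨.ite r p q, S + P + Q + 1, fun a => ?_⟩
  obtain ⟨u, hu, hu'⟩ := hr a
  obtain ⟨t, ht, hle⟩ := hp a
  obtain ⟨s, hs, hle'⟩ := hq a
  simp only [Polynomial.eval_add, Polynomial.eval_one]
  by_cases h : enc (c a) = .nil
  · rw [if_neg (by rw [hP]; simpa using h)]
    exact ⟨_, Runs.ite_false (h ▸ hu) hs, by omega⟩
  · rw [if_pos (by rw [hP]; simpa using h)]
    exact ⟨_, Runs.ite_true hu h ht, by omega⟩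

theorem ite {c : α → Bool} {f g : α → β} (hc : Poly c) (hf : Poly f) (hg : Poly g) :
    Poly (fun a => if c a = true then f a else g a) :=
  ite_enc hc (fun a => by cases c a <;> simp [enc]) hf hg

theorem cons {f : α → β} {l : α → List β} (hf : Poly f) (hl : Poly l) :
    Poly (fun a => f a :: l a) :=
  (of_enc_eq (f := fun p : β × List β => p.1 :: p.2) fun _ => rfl).comp (hf.pair hl)

theorem tail {l : α → List β} (hl : Poly l) : Poly (fun a => (l a).tail) :=
  (of_tl (f := fun l : List β => l.tail) fun l => by cases l <;> rfl).comp hl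

theorem isEmpty {l : α → List β} (hl : Poly l) : Poly (fun a => (l a).isEmpty) := by
  have := ite_enc (P := fun a => l a ≠ []) hl (fun a => by
    cases h : l a <;> simp [enc, Data.list]) (const false) (const (α := α) true)
  convert this using 2 with a
  cases l a <;> simp

theorem not {b : α → Bool} (hb : Poly b) : Poly (fun a => !(b a)) := by
  convert hb.ite (const false) (const true) using 2 with a
  cases b a <;> simp

theorem and {b c : α → Bool} (hb : Poly b) (hc : Poly c) : Poly (fun a => b a && c a) := by
  convert hb.ite hc (const false) using 2 with a
  cases b a <;> simp

theorem or {b c : α → Bool} (hb : Poly b) (hc : Poly c) : Poly (fun a => b a || c a) := by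
  convert hb.ite (const true) hc using 2 with a
  cases b a <;> simp

/-- On the empty list `hd` returns `.nil`, which need not represent the default value; hence the
branch. -/
theorem headD {l : α → List β} {d : α → β} (hl : Poly l) (hd : Poly d) :
    Poly (fun a => (l a).headD (d a)) := by
  obtain ⟨r, S, hr⟩ := hl
  obtain ⟨q, Q, hq⟩ := hd
  refine ⟨.ite r (.comp .hd r) q, S + (S + S + 1) + Q + 1, fun a => ?_⟩
  obtain ⟨u, hu, hu'⟩ := hr a
  obtain ⟨s, hs, hle'⟩ := hq a
  simp only [Polynomial.eval_add, Polynomial.eval_one]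
  cases h : l a with
  | nil =>
    rw [h] at hu
    exact ⟨_, Runs.ite_false hu hs, by omega⟩
  | cons b l' =>
    rw [h] at hu
    have := hu.size_le
    exact ⟨_, Runs.ite_true hu (by simp [enc, Data.list]) (Runs.comp hu (Runs.hd _)), by omega⟩

end Poly

/-! ### Folds, and the list functions obtained from them -/

/-- The program behind `List.foldl`: the state consists of a context, the rest of the list, and
the accumulator. -/
def Prog.fold (step : Prog) : Prog :=
  .loop (.comp .hd .tl)
    (.cons .hd (.cons (.comp .tl (.comp .hd .tl))
      (.comp step (.cons .hd (.cons (.comp .tl .tl) (.comp .hd (.comp .hd .tl)))))))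

/-- There are fewer than `sz l` passes, each costing one call of `p` and a linear overhead,
generously `20` times the state, for rearranging it. A polynomial bound for `p` alone is not enough,
since an accumulator that doubles in each pass grows exponentially; so `B` has to bound all
intermediate accumulators. -/
theorem Runs.fold {step : γ → σ → α → σ} {p : Prog} {P : Polynomial ℕ}
    (hp : ∀ c s a, ∃ t, Runs p (enc (c, s, a)) (enc (step c s a)) t ∧ t ≤ P.eval (sz (c, s, a)))
    (c : γ) (l : List α) (s : σ) (B : ℕ)
    (hB : ∀ l₁ l₂, l = l₁ ++ l₂ → sz (l₁.foldl (step c) s) ≤ B) :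
    ∃ t, Runs (Prog.fold p) (enc (c, l, s)) (enc (c, ([] : List α), l.foldl (step c) s)) t ∧
      t ≤ sz l * (P.eval (sz c + sz l + B + 2) + 20 * (sz c + sz l + B + 2)) := by
  induction l generalizing s with
  | nil =>
    refine ⟨_, Runs.loop_done (Runs.comp (Runs.tl _) (Runs.hd _)), ?_⟩
    have := hB [] [] rfl
    simp only [enc, Data.size, Data.list, Data.tl, sz, List.foldl_nil, List.map_nil] at *
    omega
  | cons a l ih =>
    obtain ⟨t, ht, hle⟩ := ih (step c s a) fun l₁ l₂ h => by
      simpa using hB (a :: l₁) l₂ (by simp [h])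
    obtain ⟨u, hu, hu'⟩ := hp c s a
    have h₀ := hB [] (a :: l) rfl
    have h₁ := hB [a] l rfl
    refine ⟨_, Runs.loop_step (Runs.comp (Runs.tl _) (Runs.hd _)) (by
      simp [enc, Data.list, Data.tl, Data.hd]) (Runs.cons (Runs.hd _) (Runs.cons
        (Runs.comp (Runs.comp (Runs.tl _) (Runs.hd _)) (Runs.tl _))
        (Runs.comp (Runs.cons (Runs.hd _) (Runs.cons (Runs.comp (Runs.tl _) (Runs.tl _))
          (Runs.comp (Runs.comp (Runs.tl _) (Runs.hd _)) (Runs.hd _)))) hu))) ht, ?_⟩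
    have e₁ : P.eval (sz (c, s, a)) ≤ P.eval (sz c + sz (a :: l) + B + 2) :=
      eval_mono P (by simp at *; omega)
    have e₂ : P.eval (sz c + sz l + B + 2) ≤ P.eval (sz c + sz (a :: l) + B + 2) :=
      eval_mono P (by simp; omega)
    have e₃ : t ≤ sz l * (P.eval (sz c + sz (a :: l) + B + 2) +
        20 * (sz c + sz (a :: l) + B + 2)) := by
      refine hle.trans (Nat.mul_le_mul le_rfl ?_)
      have : sz l ≤ sz (a :: l) := by simp; omega
      omega
    have e₄ : sz (a :: l) = sz a + sz l + 1 := rfl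
    have e₅ := one_le_sz a
    generalize P.eval (sz c + sz (a :: l) + B + 2) = X at *
    -- The first factor grows by at least one, and this additional summand pays for the present
    -- pass.
    have e₆ : sz (a :: l) * (X + 20 * (sz c + sz (a :: l) + B + 2)) ≥
        sz l * (X + 20 * (sz c + sz (a :: l) + B + 2)) +
          (X + 20 * (sz c + sz (a :: l) + B + 2)) := by
      generalize (X + 20 * (sz c + sz (a :: l) + B + 2)) = Y
      rw [e₄]; nlinarith
    refine le_trans ?_ e₆
    simp only [List.foldl_nil, enc, Data.size, Data.list, Data.tl, Data.hd, sz,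
      List.map_cons] at *
    omega

namespace Poly

theorem foldl {step : γ → σ → α → σ} {l : γ → List α} {init : γ → σ}
    (hstep : Poly fun p : γ × σ × α => step p.1 p.2.1 p.2.2) (hl : Poly l) (hinit : Poly init)
    (B : Polynomial ℕ)
    (hB : ∀ c l₁ l₂, l c = l₁ ++ l₂ → sz (l₁.foldl (step c) (init c)) ≤ B.eval (sz c)) :
    Poly (fun c => (l c).foldl (step c) (init c)) := by
  obtain ⟨p, P, hp⟩ := hstep
  have h₀ : Poly (fun c => (c, l c, init c)) := id.pair (hl.pair hinit)
  obtain ⟨L, hL⟩ := hl.exists_sz_le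
  have key : Poly (fun c => (c, ([] : List α), (l c).foldl (step c) (init c))) := by
    obtain ⟨q, Q, hq⟩ := h₀
    let S : Polynomial ℕ := Polynomial.X + L + B + 2
    refine ⟨.comp (Prog.fold p) q, Q + L * (P.comp S + 20 * S) + 1, fun c => ?_⟩
    obtain ⟨s, hs, hs'⟩ := hq c
    obtain ⟨t, ht, ht'⟩ := Runs.fold (step := step) (fun c s a => hp (c, s, a)) c (l c) (init c)
      (B.eval (sz c)) (hB c)
    refine ⟨_, Runs.comp hs ht, ?_⟩
    have hS : sz c + sz (l c) + B.eval (sz c) + 2 ≤ S.eval (sz c) := by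
      have := hL c
      simp only [S, Polynomial.eval_add, Polynomial.eval_X, Polynomial.eval_ofNat]
      omega
    have e := eval_mono P hS
    have : t ≤ L.eval (sz c) * (P.eval (S.eval (sz c)) + 20 * S.eval (sz c)) :=
      ht'.trans (Nat.mul_le_mul (hL c) (by omega))
    simp only [Polynomial.eval_add, Polynomial.eval_one, Polynomial.eval_mul, Polynomial.eval_comp,
      Polynomial.eval_ofNat]
    omega
  exact (snd.comp snd).comp key

theorem reverse {l : α → List β} (hl : Poly l) : Poly (fun a => (l a).reverse) := by
  obtain ⟨L, hL⟩ := hl.exists_sz_le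
  have := foldl (step := fun _ (s : List β) a => a :: s) (cons (snd.comp snd) (fst.comp snd)) hl
    (const []) L (fun c l₁ l₂ h => by
      have h₁ := hL c
      have h₂ := sz_append l₁ l₂
      have h₃ := one_le_sz l₂
      rw [← List.foldr_reverse]
      simp [sz_reverse]
      rw [h] at h₁; omega)
  convert this using 2 with a
  simp [← List.foldr_reverse]

theorem append {f g : α → List β} (hf : Poly f) (hg : Poly g) : Poly (fun a => f a ++ g a) := by
  obtain ⟨F, hF⟩ := hf.exists_sz_le
  obtain ⟨G, hG⟩ := hg.exists_sz_le
  have := foldl (step := fun _ (s : List β) a => a :: s) (cons (snd.comp snd) (fst.comp snd))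
    hf.reverse hg (F + G) (fun c l₁ l₂ h => by
      have h₁ := hF c
      rw [← sz_reverse, h] at h₁
      have h₂ := sz_append l₁ l₂
      have h₃ := one_le_sz l₂
      have h₄ := sz_append l₁.reverse (g c)
      have h₅ := hG c
      have h₆ := sz_reverse l₁
      rw [← List.foldr_reverse]
      simp
      omega)
  convert this using 2 with a
  simp

theorem map {F : γ → α → β} {l : γ → List α} (hF : Poly fun p : γ × α => F p.1 p.2)
    (hl : Poly l) : Poly (fun c => (l c).map (F c)) := by
  obtain ⟨P, hP⟩ := hF.exists_sz_le
  obtain ⟨L, hL⟩ := hl.exists_sz_le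
  have := foldl (step := fun c (s : List β) a => F c a :: s)
    (cons (hF.comp (fst.pair (snd.comp snd))) (fst.comp snd)) hl (const [])
    (L * (P.comp (Polynomial.X + L + 1) + 1) + 1) (fun c l₁ l₂ h => by
      have e : ∀ l : List α, ∀ s, l.foldl (fun s a => F c a :: s) s = (l.map (F c)).reverse ++ s := by
        intro l; induction l with
        | nil => simp
        | cons a l ih => intro s; simp [ih]
      rw [e, List.append_nil, sz_reverse]
      have h₁ := hL c
      simp only [Polynomial.eval_add, Polynomial.eval_one, Polynomial.eval_mul,
        Polynomial.eval_comp, Polynomial.eval_X]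
      have h₂ := length_lt_sz (l c)
      refine sz_list_le ?_ ?_
      · have := congrArg List.length h; simp at this ⊢; omega
      · intro b hb
        obtain ⟨a, ha, rfl⟩ := List.mem_map.1 hb
        refine (hP (c, a)).trans (eval_mono P ?_)
        have := sz_le_of_mem (l := l c) (a := a) (by rw [h]; simp [ha])
        simp; omega)
  -- Accumulating at the head has reversed the order.
  have := this.reverse
  convert this using 2 with c
  have e : ∀ l : List α, ∀ s, l.foldl (fun s a => F c a :: s) s = (l.map (F c)).reverse ++ s := by
    intro l; induction l with
    | nil => simp
    | cons a l ih => intro s; simp [ih]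
  simp [e]

theorem sz_flatten_append_le (l₁ l₂ : List (List α)) : sz l₁.flatten ≤ sz (l₁ ++ l₂) := by
  induction l₁ with
  | nil => simpa using one_le_sz l₂
  | cons a l ih =>
    have := sz_append a l.flatten
    simp only [List.flatten_cons, List.cons_append, sz_cons]
    omega

theorem flatten {l : α → List (List β)} (hl : Poly l) : Poly (fun a => (l a).flatten) := by
  obtain ⟨L, hL⟩ := hl.exists_sz_le
  have e : ∀ l : List (List β), ∀ s, l.foldl (fun s a => s ++ a) s = s ++ l.flatten := by
    intro l; induction l with
    | nil => simp
    | cons a l ih => intro s; simp [ih]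
  have := foldl (step := fun _ (s : List β) a => s ++ a) (append (fst.comp snd) (snd.comp snd)) hl
    (const []) L (fun c l₁ l₂ h => by
      have h₁ := hL c
      have := sz_flatten_append_le l₁ l₂
      rw [e, List.nil_append]
      rw [h] at h₁; omega)
  convert this using 2 with a
  simp [e]

theorem flatMap {F : γ → α → List β} {l : γ → List α} (hF : Poly fun p : γ × α => F p.1 p.2)
    (hl : Poly l) : Poly (fun c => (l c).flatMap (F c)) := by
  simpa only [List.flatMap_def] using (hF.map hl).flatten

theorem filter {F : γ → α → Bool} {l : γ → List α} (hF : Poly fun p : γ × α => F p.1 p.2)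
    (hl : Poly l) : Poly (fun c => (l c).filter (F c)) := by
  convert flatMap (F := fun c a => if F c a = true then [a] else [])
    (hF.ite (snd.cons (const [])) (const [])) hl using 2 with c
  induction l c with
  | nil => rfl
  | cons a l ih => by_cases h : F c a <;> simp [h, ih]

theorem any {F : γ → α → Bool} {l : γ → List α} (hF : Poly fun p : γ × α => F p.1 p.2)
    (hl : Poly l) : Poly (fun c => (l c).any (F c)) := by
  convert (hF.filter hl).isEmpty.not using 2 with c
  induction l c with
  | nil => rfl
  | cons a l ih => by_cases h : F c a <;> simp [h, ih]

theorem all {F : γ → α → Bool} {l : γ → List α} (hF : Poly fun p : γ × α => F p.1 p.2)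
    (hl : Poly l) : Poly (fun c => (l c).all (F c)) := by
  convert (any (F := fun c a => !F c a) hF.not hl).not using 2 with c
  simp [List.all_eq_not_any_not]

/-! ### Arithmetic -/

/-- Unary numbers and lists of units are the same trees, so arithmetic reduces to list operations.
-/
theorem enc_replicate_unit (n : ℕ) : enc (List.replicate n ()) = enc n := by
  induction n with
  | zero => rfl
  | succ n ih => exact congrArg (Data.cons Data.nil) ih

theorem replicate_unit {n : α → ℕ} (hn : Poly n) : Poly (fun a => List.replicate (n a) ()) :=
  (of_enc_eq (f := fun n : ℕ => List.replicate n ()) enc_replicate_unit).comp hn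

theorem length {l : α → List β} (hl : Poly l) : Poly (fun a => (l a).length) := by
  have h : Poly (fun l : List Unit => l.length) := of_enc_eq fun l => by
    rw [← enc_replicate_unit]
    congr 1
    exact (List.eq_replicate_iff.2 ⟨rfl, fun _ _ => rfl⟩).symm
  convert h.comp (map (F := fun _ _ => ()) (const ()) hl) using 2 with a
  simp

theorem add {m n : α → ℕ} (hm : Poly m) (hn : Poly n) : Poly (fun a => m a + n a) := by
  convert (hm.replicate_unit.append hn.replicate_unit).length using 2 with a
  simp

theorem mul {m n : α → ℕ} (hm : Poly m) (hn : Poly n) : Poly (fun a => m a * n a) := by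
  convert (flatMap (F := fun a _ => List.replicate (n a) ()) (hn.comp fst).replicate_unit
    hm.replicate_unit).length using 2 with a
  simp

/-- Iteration of a function as long as all values are of polynomial size. -/
theorem iterate {step : γ → σ → σ} {n : γ → ℕ} {init : γ → σ}
    (hstep : Poly fun p : γ × σ => step p.1 p.2) (hn : Poly n) (hinit : Poly init)
    (B : Polynomial ℕ) (hB : ∀ c i, i ≤ n c → sz ((step c)^[i] (init c)) ≤ B.eval (sz c)) :
    Poly (fun c => (step c)^[n c] (init c)) := by
  have e : ∀ c (l : List Unit) s, l.foldl (fun s _ => step c s) s = (step c)^[l.length] s := by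
    intro c l; induction l with
    | nil => simp
    | cons a l ih => intro s; simp [ih]
  have := foldl (step := fun c s (_ : Unit) => step c s) (hstep.comp (fst.pair (fst.comp snd)))
    hn.replicate_unit hinit B (fun c l₁ l₂ h => by
      rw [e]
      refine hB c _ ?_
      have := congrArg List.length h
      simp at this; omega)
  convert this using 2 with c
  simp [e]

theorem iterate_tail {β : Type*} (l : List β) (n : ℕ) :
    (fun l : List β => l.tail)^[n] l = l.drop n := by
  induction n generalizing l with
  | zero => simp
  | succ n ih => rw [Function.iterate_succ_apply, ih]; simp

theorem sz_drop_le (l : List α) (n : ℕ) : sz (l.drop n) ≤ sz l := by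
  have := sz_append (l.take n) (l.drop n)
  rw [List.take_append_drop] at this
  have := one_le_sz (l.take n)
  omega

theorem drop {n : α → ℕ} {l : α → List β} (hn : Poly n) (hl : Poly l) :
    Poly (fun a => (l a).drop (n a)) := by
  obtain ⟨L, hL⟩ := hl.exists_sz_le
  have := iterate (step := fun (_ : α) (s : List β) => s.tail) snd.tail hn hl L (fun c i _ => by
    rw [iterate_tail]
    exact (sz_drop_le _ _).trans (hL c))
  simpa only [iterate_tail] using this

theorem getD {l : α → List β} {n : α → ℕ} {d : α → β} (hl : Poly l) (hn : Poly n) (hd : Poly d) :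
    Poly (fun a => (l a).getD (n a) (d a)) := by
  convert (hn.drop hl).headD hd using 2 with a
  simp [List.getD_eq_getElem?_getD, List.headD_eq_head?_getD]

theorem sub {m n : α → ℕ} (hm : Poly m) (hn : Poly n) : Poly (fun a => m a - n a) := by
  convert (hn.drop hm.replicate_unit).length using 2 with a
  simp

theorem decide_lt {m n : α → ℕ} (hm : Poly m) (hn : Poly n) :
    Poly (fun a => decide (m a < n a)) := by
  convert (hn.sub hm).replicate_unit.isEmpty.not using 2 with a
  cases h : n a - m a <;> simp [List.replicate_succ] <;> omega

theorem decide_eq {m n : α → ℕ} (hm : Poly m) (hn : Poly n) :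
    Poly (fun a => decide (m a = n a)) := by
  convert (hm.decide_lt hn).not.and (hn.decide_lt hm).not using 2 with a
  by_cases h : m a = n a
  · simp [h]
  · have : m a < n a ∨ n a < m a := by omega
    rcases this with h' | h' <;> simp [h, h']

theorem range {n : α → ℕ} (hn : Poly n) : Poly (fun a => List.range (n a)) := by
  obtain ⟨N, hN⟩ := hn.exists_sz_le
  have e : ∀ i : ℕ, (fun s : List ℕ => s ++ [s.length])^[i] [] = List.range i := by
    intro i; induction i with
    | zero => rfl
    | succ i ih => rw [Function.iterate_succ_apply', ih]; simp [List.range_succ]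
  have := iterate (step := fun (_ : α) (s : List ℕ) => s ++ [s.length])
    (append snd (snd.length.cons (const []))) hn (const []) (N * (N + 1) + 1) (fun c i hi => by
      rw [e]
      have h₁ := hN c
      rw [sz_nat] at h₁
      simp only [Polynomial.eval_add, Polynomial.eval_one, Polynomial.eval_mul]
      refine sz_list_le (by simp; omega) fun a ha => ?_
      have := List.mem_range.1 ha
      simp; omega)
  simpa only [e] using this

theorem take {n : α → ℕ} {l : α → List β} (hn : Poly n) (hl : Poly l) :
    Poly (fun a => (l a).take (n a)) := by
  convert ((hl.length.sub hn).drop hl.reverse).reverse using 2 with a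
  rw [List.drop_reverse, List.reverse_reverse]
  by_cases h : n a ≤ (l a).length
  · congr 1; omega
  · rw [List.take_of_length_le (by omega), List.take_of_length_le (by omega)]

theorem contains {l : α → List ℕ} {n : α → ℕ} (hl : Poly l) (hn : Poly n) :
    Poly (fun a => decide (n a ∈ l a)) := by
  convert any (F := fun a b => decide (n a = b)) ((hn.comp fst).decide_eq snd) hl using 2 with a
  induction l a with
  | nil => simp
  | cons b l ih => simp [← ih]

theorem beq_bool {b c : α → Bool} (hb : Poly b) (hc : Poly c) : Poly (fun a => b a == c a) := by
  convert hb.ite hc hc.not using 2 with a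
  cases b a <;> cases c a <;> rfl

end Poly

end

/-! ### Gate tables -/

section GateTable

variable {G α : Type*} (step : List α → G → α)

theorem gateTable_concat (C : List G) (g : G) :
    gateTable step (C ++ [g]) = gateTable step C ++ [step (gateTable step C) g] := by
  simp [gateTable]

@[simp] theorem length_gateTable (C : List G) : (gateTable step C).length = C.length := by
  induction C using List.reverseRecOn with
  | nil => rfl
  | append_singleton C g ih => simp [gateTable_concat, ih]

theorem gateTable_getElem (C : List G) (t : ℕ) (ht : t < C.length) :
    (gateTable step C)[t]'(by simpa using ht) = step ((gateTable step C).take t) C[t] := by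
  induction C using List.reverseRecOn with
  | nil => simp at ht
  | append_singleton C g ih =>
    simp only [gateTable_concat]
    rcases Nat.lt_or_ge t C.length with h | h
    · rw [List.getElem_append_left (by simpa using h), ih h, List.getElem_append_left h,
        List.take_append_of_le_length (by simpa using h.le)]
    · have : t = C.length := by simp at ht; omega
      subst this
      rw [List.take_append_of_le_length (by simp), List.take_of_length_le (by simp)]
      simp

theorem getD_take_of_lt (v : List α) {a t : ℕ} (h : a < t) (d : α) :
    (v.take t).getD a d = v.getD a d := by
  simp [List.getD_eq_getElem?_getD, h]

/-- A list that satisfies the defining recursion of the gate table is the gate table. -/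
theorem eq_gateTable {C : List G} {v : List α} (hl : v.length = C.length)
    (h : ∀ (t : ℕ) (ht : t < C.length), v[t]'(hl ▸ ht) = step (v.take t) C[t]) :
    gateTable step C = v := by
  have : ∀ t ≤ C.length, (gateTable step C).take t = v.take t := by
    intro t
    induction t with
    | zero => simp
    | succ t ih =>
      intro ht
      have e := ih (by omega)
      rw [List.take_succ_eq_append_getElem (by simpa using ht),
        List.take_succ_eq_append_getElem (by omega), e, gateTable_getElem step C t ht, h t ht, e]
  have := this C.length le_rfl
  rwa [List.take_of_length_le (by simp), List.take_of_length_le (by omega)] at this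

end GateTable

/-! ### Evaluation of Boolean circuits at single gates -/

namespace BoolCircuit

/-- The gate at a given position. -/
def gate (C : BoolCircuit) (g : ℕ) : BoolGate := C.getD g .input

/-- The truth value of a gate when the inputs in `T` are true. -/
def val (C : BoolCircuit) (T : Finset ℕ) (g : ℕ) : Bool :=
  (gateTable (BoolGate.value T) C).getD g false

/-- The depth of a gate. -/
def depthAt (C : BoolCircuit) (g : ℕ) : ℕ := (gateTable BoolGate.depth C).getD g 0

/-- The weft of a gate. -/
def weftAt (C : BoolCircuit) (g : ℕ) : ℕ := (gateTable BoolGate.weft C).getD g 0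

theorem gate_eq {C : BoolCircuit} {g : ℕ} (h : g < C.length) : C.gate g = C[g] := by
  simp [gate, h]

namespace WellFormed

variable {C : BoolCircuit} (hC : C.WellFormed) {g : ℕ} (hg : g < C.length)
include hC hg

theorem lt_of_mem_args {a : ℕ} (ha : a ∈ (C.gate g).args) : a < g :=
  hC.acyclic g hg a (gate_eq hg ▸ ha)

theorem args_ne_nil (hi : C.gate g ≠ .input) : (C.gate g).args ≠ [] := by
  have h := hC.proper (C.gate g) (by rw [gate_eq hg]; exact List.getElem_mem _)
  revert h hi
  cases C.gate g <;> simp [BoolGate.Proper]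

/-- The table is computed from prefixes; acyclicity allows lookups in the whole table instead. -/
theorem val_eq (T : Finset ℕ) : C.val T g = match C.gate g with
    | .input => decide (g ∈ T)
    | .neg a => !(C.val T a)
    | .conj l => l.all (C.val T)
    | .disj l => l.any (C.val T) := by
  have hlt : ∀ a ∈ (C.gate g).args, a < g := fun a => hC.lt_of_mem_args hg
  have e : C.val T g = BoolGate.value T ((gateTable (BoolGate.value T) C).take g) (C.gate g) := by
    rw [gate_eq hg, ← gateTable_getElem (BoolGate.value T) _ _ hg]
    simp [val, hg]
  rw [e]
  revert hlt
  cases C.gate g with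
  | input => intro _; simp [BoolGate.value, hg.le]
  | neg a => intro h; simp only [BoolGate.value, getD_take_of_lt _ (h a (by simp [BoolGate.args]))]; rfl
  | conj l =>
    intro h
    simp only [BoolGate.value]
    rw [Bool.eq_iff_iff, List.all_eq_true, List.all_eq_true]
    exact forall₂_congr fun a ha => by rw [getD_take_of_lt _ (h a ha)]; rfl
  | disj l =>
    intro h
    simp only [BoolGate.value]
    rw [Bool.eq_iff_iff, List.any_eq_true, List.any_eq_true]
    exact exists_congr fun a => and_congr_right fun ha => by rw [getD_take_of_lt _ (h a ha)]; rfl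

theorem depthAt_lt (hi : C.gate g ≠ .input) {a : ℕ} (ha : a ∈ (C.gate g).args) :
    C.depthAt a < C.depthAt g := by
  have hlt := hC.lt_of_mem_args hg ha
  have e : C.depthAt g = BoolGate.depth ((gateTable BoolGate.depth C).take g) (C.gate g) := by
    rw [gate_eq hg, ← gateTable_getElem BoolGate.depth _ _ hg]
    simp [depthAt, hg]
  have e' : BoolGate.depth ((gateTable BoolGate.depth C).take g) (C.gate g) =
      ((C.gate g).args.map fun a => ((gateTable BoolGate.depth C).take g).getD a 0).foldr max 0
        + 1 := by
    revert hi
    cases C.gate g <;> simp [BoolGate.depth]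
  rw [e, e', Nat.lt_succ_iff]
  refine List.le_max_of_le (List.mem_map.2 ⟨a, ha, rfl⟩) ?_
  rw [getD_take_of_lt _ hlt]; rfl

theorem gate_eq_input (h : C.depthAt g = 0) : C.gate g = .input := by
  by_contra hi
  obtain ⟨a, ha⟩ := List.exists_mem_of_ne_nil _ (hC.args_ne_nil hg hi)
  have := hC.depthAt_lt hg hi ha
  omega

theorem weftAt_add_le {a : ℕ} (ha : a ∈ (C.gate g).args) :
    C.weftAt a + (if 2 < (C.gate g).args.length then 1 else 0) ≤ C.weftAt g := by
  have hlt := hC.lt_of_mem_args hg ha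
  have e : C.weftAt g = BoolGate.weft ((gateTable BoolGate.weft C).take g) (C.gate g) := by
    rw [gate_eq hg, ← gateTable_getElem BoolGate.weft _ _ hg]
    simp [weftAt, hg]
  rw [e, BoolGate.weft]
  refine Nat.add_le_add_right (List.le_max_of_le (List.mem_map.2 ⟨a, ha, rfl⟩) ?_) _
  rw [getD_take_of_lt _ hlt]; rfl

theorem weftAt_le {a : ℕ} (ha : a ∈ (C.gate g).args) : C.weftAt a ≤ C.weftAt g :=
  (Nat.le_add_right _ _).trans (hC.weftAt_add_le hg ha)

theorem length_args_le_two (h : C.weftAt g = 0) : (C.gate g).args.length ≤ 2 := by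
  by_contra hlt
  obtain ⟨a, ha⟩ := List.exists_mem_of_length_pos (l := (C.gate g).args) (by omega)
  have := hC.weftAt_add_le hg ha
  rw [if_pos (by omega)] at this
  omega

end WellFormed

theorem getLastD_eq_getD {α : Type*} (l : List α) (d : α) :
    l.getLastD d = l.getD (l.length - 1) d := by
  rw [List.getLastD_eq_getLast?, List.getLast?_eq_getElem?, List.getD_eq_getElem?_getD]

theorem eval_eq_val (C : BoolCircuit) (T : Finset ℕ) : C.eval T = C.val T (C.length - 1) := by
  rw [eval, getLastD_eq_getD, length_gateTable]; rfl

theorem depth_eq_depthAt (C : BoolCircuit) : C.depth = C.depthAt (C.length - 1) := by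
  rw [depth, getLastD_eq_getD, length_gateTable]; rfl

theorem weft_eq_weftAt (C : BoolCircuit) : C.weft = C.weftAt (C.length - 1) := by
  rw [weft, getLastD_eq_getD, length_gateTable]; rfl

/-- The truth value of a gate of depth at most `e` when the inputs in `U` are true. -/
def evalAt : ℕ → BoolCircuit → List ℕ → ℕ → Bool
  | 0, _, U, g => decide (g ∈ U)
  | e + 1, C, U, g => match C.gate g with
    | .input => decide (g ∈ U)
    | .neg a => !(evalAt e C U a)
    | .conj l => l.all (evalAt e C U)
    | .disj l => l.any (evalAt e C U)

/-- The inputs on which a gate of depth at most `e` depends. -/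
def support : ℕ → BoolCircuit → ℕ → List ℕ
  | 0, _, g => [g]
  | e + 1, C, g => match C.gate g with
    | .input => [g]
    | G => G.args.flatMap (support e C)

/-- The depth drops along every wire, so fuel `e` lasts until an input is reached. The recursion on
a constant `e`, rather than along the list of gates, is what gives locality and polynomial time. -/
theorem WellFormed.evalAt_eq_val {C : BoolCircuit} (hC : C.WellFormed) (T : Finset ℕ) (U : List ℕ)
    (hU : ∀ a, a ∈ U ↔ a ∈ T) (e : ℕ) {g : ℕ} (hg : g < C.length) (he : C.depthAt g ≤ e) :
    evalAt e C U g = C.val T g := by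
  induction e generalizing g with
  | zero =>
    rw [hC.val_eq hg, hC.gate_eq_input hg (by omega)]
    simp [evalAt, hU]
  | succ e ih =>
    have h : C.gate g ≠ .input → ∀ a ∈ (C.gate g).args, evalAt e C U a = C.val T a :=
      fun hi a ha => ih ((hC.lt_of_mem_args hg ha).trans hg) (by
        have := hC.depthAt_lt hg hi ha; omega)
    rw [hC.val_eq hg, evalAt]
    revert h
    cases C.gate g with
    | input => simp [hU]
    | neg a => intro h; simp [h (by simp) a (by simp [BoolGate.args])]
    | conj l =>
      intro h
      simp only
      rw [Bool.eq_iff_iff, List.all_eq_true, List.all_eq_true]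
      exact forall₂_congr fun a ha => by rw [h (by simp) a ha]
    | disj l =>
      intro h
      simp only
      rw [Bool.eq_iff_iff, List.any_eq_true, List.any_eq_true]
      exact exists_congr fun a => and_congr_right fun ha => by rw [h (by simp) a ha]

theorem support_succ_of_ne {e : ℕ} {C : BoolCircuit} {g : ℕ} (hi : C.gate g ≠ .input) :
    support (e + 1) C g = (C.gate g).args.flatMap (support e C) := by
  rw [support]
  revert hi
  cases C.gate g <;> simp

theorem evalAt_congr {e : ℕ} {C : BoolCircuit} {U U' : List ℕ} {g : ℕ}
    (h : ∀ a ∈ support e C g, a ∈ U ↔ a ∈ U') : evalAt e C U g = evalAt e C U' g := by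
  induction e generalizing g with
  | zero => simpa [evalAt, support] using h
  | succ e ih =>
    by_cases hi : C.gate g = .input
    · simpa [evalAt, support, hi] using h
    · rw [support_succ_of_ne hi] at h
      have h' : ∀ a ∈ (C.gate g).args, evalAt e C U a = evalAt e C U' a := fun a ha =>
        ih fun b hb => h b (List.mem_flatMap.2 ⟨a, ha, hb⟩)
      rw [evalAt, evalAt]
      revert h' hi
      cases C.gate g with
      | input => simp
      | neg a => intro _ h; simp [h a (by simp [BoolGate.args])]
      | conj l =>
        intro _ h
        simp only
        rw [Bool.eq_iff_iff, List.all_eq_true, List.all_eq_true]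
        exact forall₂_congr fun a ha => by rw [h a ha]
      | disj l =>
        intro _ h
        simp only
        rw [Bool.eq_iff_iff, List.any_eq_true, List.any_eq_true]
        exact exists_congr fun a => and_congr_right fun ha => by rw [h a ha]

theorem WellFormed.lt_of_mem_support {C : BoolCircuit} (hC : C.WellFormed) {e g : ℕ}
    (hg : g < C.length) {a : ℕ} (ha : a ∈ support e C g) : a < C.length := by
  induction e generalizing g with
  | zero => simp [support] at ha; omega
  | succ e ih =>
    by_cases hi : C.gate g = .input
    · simp [support, hi] at ha; omega
    · rw [support_succ_of_ne hi] at ha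
      obtain ⟨b, hb, hab⟩ := List.mem_flatMap.1 ha
      exact ih ((hC.lt_of_mem_args hg hb).trans hg) hab

/-- Below a gate of weft zero all gates have fan-in at most two, so unfolding gives a tree with at
most `2 ^ e` leaves. -/
theorem WellFormed.length_support_le {C : BoolCircuit} (hC : C.WellFormed) {e g : ℕ}
    (hg : g < C.length) (hw : C.weftAt g = 0) : (support e C g).length ≤ 2 ^ e := by
  induction e generalizing g with
  | zero => simp [support]
  | succ e ih =>
    by_cases hi : C.gate g = .input
    · simpa [support, hi] using Nat.one_le_two_pow
    · rw [support_succ_of_ne hi, List.length_flatMap]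
      have h₁ := hC.length_args_le_two hg hw
      have h₂ : ((C.gate g).args.map fun a => (support e C a).length).sum ≤
          ((C.gate g).args.map fun a => (support e C a).length).length • 2 ^ e :=
        List.sum_le_card_nsmul _ _ fun x hx => by
          obtain ⟨a, ha, rfl⟩ := List.mem_map.1 hx
          exact ih ((hC.lt_of_mem_args hg ha).trans hg) (by
            have := hC.weftAt_le hg ha; omega)
      refine h₂.trans ?_
      rw [List.length_map, smul_eq_mul, pow_succ, mul_comm]
      exact Nat.mul_le_mul le_rfl h₁

/-! ### A disjunctive normal form for circuits of weft one -/

/-- The truth values `V` are as prescribed by `w`. -/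
def Meets (V : ℕ → Bool) (w : List (ℕ × Bool)) : Prop := ∀ p ∈ w, V p.1 = p.2

theorem meets_singleton {V : ℕ → Bool} {g : ℕ} {b : Bool} : Meets V [(g, b)] ↔ V g = b := by
  simp only [Meets, List.mem_singleton, forall_eq]

theorem meets_append {V : ℕ → Bool} {u v : List (ℕ × Bool)} :
    Meets V (u ++ v) ↔ Meets V u ∧ Meets V v := by
  simp only [Meets, List.forall_mem_append]

theorem meets_map {V : ℕ → Bool} {l : List ℕ} {b : Bool} :
    Meets V (l.map fun a => (a, b)) ↔ ∀ a ∈ l, V a = b := by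
  simp only [Meets, List.forall_mem_map]

/-- A choice of one of the alternatives in each of the two lists. -/
def pairwiseAppend {α : Type*} (L L' : List (List α)) : List (List α) :=
  L.flatMap fun u => L'.map fun v => u ++ v

/-- Alternatives for "all gates of `l` have the value `b`". -/
def altsAll (D : ℕ → List (List (ℕ × Bool))) (l : List ℕ) (b : Bool) : List (List (ℕ × Bool)) :=
  if 2 < l.length then [l.map fun a => (a, b)]
  else pairwiseAppend (D (l.headD 0)) (D (l.getD 1 (l.headD 0)))

/-- Alternatives for "some gate of `l` has the value `b`". -/
def altsAny (D : ℕ → List (List (ℕ × Bool))) (l : List ℕ) (b : Bool) : List (List (ℕ × Bool)) :=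
  if 2 < l.length then l.map fun a => [(a, b)] else l.flatMap D

/-- Lists of prescribed values of gates such that gate `g` has the value `b` if and only if the
prescriptions of one of the lists are met. The gates are predecessors of large gates, or inputs. -/
def alts : ℕ → BoolCircuit → ℕ → Bool → List (List (ℕ × Bool))
  | 0, _, g, b => [[(g, b)]]
  | e + 1, C, g, b => match C.gate g with
    | .input => [[(g, b)]]
    | .neg a => alts e C a (!b)
    | .conj l => if b then altsAll (fun a => alts e C a b) l b else
        altsAny (fun a => alts e C a b) l b
    | .disj l => if b then altsAny (fun a => alts e C a b) l b else
        altsAll (fun a => alts e C a b) l b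

theorem exists_altsAll {V : ℕ → Bool} {D : ℕ → List (List (ℕ × Bool))} {l : List ℕ} {b : Bool}
    (hl : l ≠ []) (hD : ∀ a ∈ l, (∃ w ∈ D a, Meets V w) ↔ V a = b) :
    (∃ w ∈ altsAll D l b, Meets V w) ↔ ∀ a ∈ l, V a = b := by
  rw [altsAll]
  split_ifs with h
  · simp [meets_map]
  · have key : ∀ x y, (∃ w ∈ pairwiseAppend (D x) (D y), Meets V w) ↔
        (∃ w ∈ D x, Meets V w) ∧ (∃ w ∈ D y, Meets V w) := by
      intro x y
      simp only [pairwiseAppend, List.mem_flatMap, List.mem_map]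
      constructor
      · rintro ⟨_, ⟨u, hu, v, hv, rfl⟩, h⟩
        rw [meets_append] at h
        exact ⟨⟨u, hu, h.1⟩, ⟨v, hv, h.2⟩⟩
      · rintro ⟨⟨u, hu, h⟩, ⟨v, hv, h'⟩⟩
        exact ⟨_, ⟨u, hu, v, hv, rfl⟩, meets_append.2 ⟨h, h'⟩⟩
    rw [key]
    match l, hl, h, hD with
    -- The default value of `getD` pairs a single predecessor with itself.
    | [a], _, _, hD => simp [hD a (by simp)]
    | [a, a'], _, _, hD => simp [hD a (by simp), hD a' (by simp)]
    | _ :: _ :: _ :: _, _, h, _ => simp at h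

theorem exists_altsAny {V : ℕ → Bool} {D : ℕ → List (List (ℕ × Bool))} {l : List ℕ} {b : Bool}
    (hD : ∀ a ∈ l, (∃ w ∈ D a, Meets V w) ↔ V a = b) :
    (∃ w ∈ altsAny D l b, Meets V w) ↔ ∃ a ∈ l, V a = b := by
  rw [altsAny]
  split_ifs with h
  · simp [meets_singleton]
  · simp only [List.mem_flatMap]
    constructor
    · rintro ⟨w, ⟨a, ha, hw⟩, h⟩
      exact ⟨a, ha, (hD a ha).1 ⟨w, hw, h⟩⟩
    · rintro ⟨a, ha, h⟩
      obtain ⟨w, hw, h⟩ := (hD a ha).2 h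
      exact ⟨w, ⟨a, ha, hw⟩, h⟩

/-- Negations flip the prescribed value, and conjunctions and disjunctions exchange roles when it is
`false`. No bound on the depth is needed: when the fuel runs out, the gate itself is prescribed. -/
theorem WellFormed.exists_alts {C : BoolCircuit} (hC : C.WellFormed) (T : Finset ℕ) (e : ℕ) {g : ℕ}
    (hg : g < C.length) (b : Bool) :
    (∃ w ∈ alts e C g b, Meets (C.val T) w) ↔ C.val T g = b := by
  induction e generalizing g b with
  | zero => simp [alts, meets_singleton]
  | succ e ih =>
    have h : ∀ a ∈ (C.gate g).args, ∀ b,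
        (∃ w ∈ alts e C a b, Meets (C.val T) w) ↔ C.val T a = b :=
      fun a ha b => ih ((hC.lt_of_mem_args hg ha).trans hg) b
    have hn := hC.args_ne_nil hg
    have hv := hC.val_eq hg T
    rw [alts]
    revert h hv hn
    cases C.gate g with
    | input => intro _ _ _; simp [meets_singleton]
    | neg a =>
      intro h _ hv
      simp only [h a (by simp [BoolGate.args]), hv]
      cases C.val T a <;> cases b <;> simp
    | conj l =>
      intro h hn hv
      have hn : l ≠ [] := hn (by simp)
      have h : ∀ a ∈ l, _ := h
      simp only [hv]
      cases b with
      | true => simp [exists_altsAll hn fun a ha => h a ha true]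
      | false => simp [exists_altsAny fun a ha => h a ha false]
    | disj l =>
      intro h hn hv
      have hn : l ≠ [] := hn (by simp)
      have h : ∀ a ∈ l, _ := h
      simp only [hv]
      cases b with
      | true => simp [exists_altsAny fun a ha => h a ha true]
      | false => simp [exists_altsAll hn fun a ha => h a ha false]

theorem mem_altsAll {D : ℕ → List (List (ℕ × Bool))} {l : List ℕ} {b : Bool} (hl : l ≠ [])
    {w : List (ℕ × Bool)} (hw : w ∈ altsAll D l b) {p : ℕ × Bool} (hp : p ∈ w) :
    (2 < l.length ∧ p.1 ∈ l) ∨ ∃ a ∈ l, ∃ w ∈ D a, p ∈ w := by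
  rw [altsAll] at hw
  split_ifs at hw with h
  · simp only [List.mem_singleton] at hw
    subst hw
    obtain ⟨a, ha, rfl⟩ := List.mem_map.1 hp
    exact Or.inl ⟨h, ha⟩
  · right
    simp only [pairwiseAppend, List.mem_flatMap, List.mem_map] at hw
    obtain ⟨u, hu, v, hv, rfl⟩ := hw
    have h₁ : l.headD 0 ∈ l := by cases l <;> simp_all
    have h₂ : l.getD 1 (l.headD 0) ∈ l := by
      match l, hl with
      | [a], _ => simp
      | a :: a' :: l, _ => simp
    rcases List.mem_append.1 hp with hp | hp
    exacts [⟨_, h₁, u, hu, hp⟩, ⟨_, h₂, v, hv, hp⟩]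

theorem mem_altsAny {D : ℕ → List (List (ℕ × Bool))} {l : List ℕ} {b : Bool}
    {w : List (ℕ × Bool)} (hw : w ∈ altsAny D l b) {p : ℕ × Bool} (hp : p ∈ w) :
    (2 < l.length ∧ p.1 ∈ l) ∨ ∃ a ∈ l, ∃ w ∈ D a, p ∈ w := by
  rw [altsAny] at hw
  split_ifs at hw with h
  · obtain ⟨a, ha, rfl⟩ := List.mem_map.1 hw
    simp only [List.mem_singleton] at hp
    subst hp
    exact Or.inl ⟨h, ha⟩
  · obtain ⟨a, ha, hw⟩ := List.mem_flatMap.1 hw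
    exact Or.inr ⟨a, ha, w, hw, hp⟩

/-- A prescription arises at an input or just below a large gate, and that gate uses up the whole
weft. The bound `e` guarantees that fuel runs out only at inputs; `d` stays fixed during the
induction. -/
theorem WellFormed.weftAt_of_mem_alts {C : BoolCircuit} (hC : C.WellFormed) {d e g : ℕ}
    (hg : g < C.length) (hw : C.weftAt g ≤ 1) (he : C.depthAt g ≤ e) (hd : C.depthAt g ≤ d)
    {b : Bool} {w : List (ℕ × Bool)} (h : w ∈ alts e C g b) {p : ℕ × Bool} (hp : p ∈ w) :
    p.1 < C.length ∧ C.weftAt p.1 = 0 ∧ C.depthAt p.1 ≤ d := by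
  have hin : ∀ {g}, g < C.length → C.gate g = .input → C.weftAt g = 0 := by
    intro g hg hi
    have e : C.weftAt g = BoolGate.weft ((gateTable BoolGate.weft C).take g) (C.gate g) := by
      rw [gate_eq hg, ← gateTable_getElem BoolGate.weft _ _ hg]
      simp [weftAt, hg]
    rw [e, hi]; rfl
  induction e generalizing g b w with
  | zero =>
    simp only [alts, List.mem_singleton] at h
    subst h
    simp only [List.mem_singleton] at hp
    subst hp
    exact ⟨hg, hin hg (hC.gate_eq_input hg (Nat.le_zero.1 he)), hd⟩
  | succ e ih =>
    by_cases hi : C.gate g = .input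
    · simp only [alts, hi, List.mem_singleton] at h
      subst h
      simp only [List.mem_singleton] at hp
      subst hp
      exact ⟨hg, hin hg hi, hd⟩
    · have key : (2 < (C.gate g).args.length ∧ p.1 ∈ (C.gate g).args) ∨
          ∃ a ∈ (C.gate g).args, ∃ b, ∃ w ∈ alts e C a b, p ∈ w := by
        have hn := hC.args_ne_nil hg hi
        rw [alts] at h
        revert h hn hi
        cases C.gate g with
        | input => simp
        | neg a => intro h _ _; exact Or.inr ⟨a, by simp [BoolGate.args], _, w, h, hp⟩
        | conj l =>
          intro h _ hn
          simp only at h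
          split_ifs at h
          · rcases mem_altsAll hn h hp with h | ⟨a, ha, w, hw, hp⟩
            exacts [Or.inl h, Or.inr ⟨a, ha, _, w, hw, hp⟩]
          · rcases mem_altsAny h hp with h | ⟨a, ha, w, hw, hp⟩
            exacts [Or.inl h, Or.inr ⟨a, ha, _, w, hw, hp⟩]
        | disj l =>
          intro h _ hn
          simp only at h
          split_ifs at h
          · rcases mem_altsAny h hp with h | ⟨a, ha, w, hw, hp⟩
            exacts [Or.inl h, Or.inr ⟨a, ha, _, w, hw, hp⟩]
          · rcases mem_altsAll hn h hp with h | ⟨a, ha, w, hw, hp⟩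
            exacts [Or.inl h, Or.inr ⟨a, ha, _, w, hw, hp⟩]
      rcases key with ⟨hlt, ha⟩ | ⟨a, ha, b, w, hw', hp⟩
      · have h₁ := hC.weftAt_add_le hg ha
        have h₂ := hC.depthAt_lt hg hi ha
        rw [if_pos hlt] at h₁
        exact ⟨(hC.lt_of_mem_args hg ha).trans hg, by omega, by omega⟩
      · have h₁ := hC.weftAt_le hg ha
        have h₂ := hC.depthAt_lt hg hi ha
        exact ih ((hC.lt_of_mem_args hg ha).trans hg) (by omega) (by omega) (by omega) hw' hp

end BoolCircuit

/-! ### Polynomial time computability of these functions -/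

/-- The kind of a gate. -/
def BoolGate.tag : BoolGate → ℕ
  | .input => 0
  | .neg _ => 1
  | .conj _ => 2
  | .disj _ => 3

section

variable {α : Type*} [Enc α]

namespace Poly

open BoolCircuit

theorem tag {G : α → BoolGate} (hG : Poly G) : Poly (fun a => (G a).tag) :=
  (of_hd (f := BoolGate.tag) fun G => by cases G <;> rfl).comp hG

theorem args {G : α → BoolGate} (hG : Poly G) : Poly (fun a => (G a).args) := by
  have h : Poly BoolGate.args := by
    obtain ⟨p, P, hp⟩ : Poly (fun G : BoolGate => decide (G.tag = 1)) :=
      (tag id).decide_eq (const 1)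
    -- The encoding of `neg` contains a bare number, which is wrapped into a one-element list; for
    -- the other gates the tail already represents the list.
    refine ⟨.ite p (.cons .tl .nil) .tl, P + .X + 3, fun G => ?_⟩
    obtain ⟨t, ht, hle⟩ := hp G
    simp only [Polynomial.eval_add, Polynomial.eval_X, Polynomial.eval_ofNat]
    cases G with
    | neg a => exact ⟨_, Runs.ite_true ht (by simp [enc, BoolGate.tag])
        (Runs.cons (Runs.tl _) (Runs.nil _)), by simp only [sz] at *; omega⟩
    | input => exact ⟨_, Runs.ite_false ht (Runs.tl _), by simp only [sz] at *; omega⟩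
    | conj l => exact ⟨_, Runs.ite_false ht (Runs.tl _), by simp only [sz] at *; omega⟩
    | disj l => exact ⟨_, Runs.ite_false ht (Runs.tl _), by simp only [sz] at *; omega⟩
  exact h.comp hG

theorem gate {C : α → BoolCircuit} {g : α → ℕ} (hC : Poly C) (hg : Poly g) :
    Poly (fun a => (C a).gate (g a)) :=
  hC.getD hg (const _)

theorem ite_tag {β : Type*} [Enc β] {G : α → BoolGate} {n : ℕ} {f g : α → β} (hG : Poly G)
    (hf : Poly f) (hg : Poly g) : Poly (fun a => if (G a).tag = n then f a else g a) := by
  simpa using (hG.tag.decide_eq (const n)).ite hf hg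

/-- The induction on the constant `e` builds a different program for each `e`, with nested loops;
the degree of the time bound may grow with `e`. -/
theorem evalAt {C : α → BoolCircuit} {U : α → List ℕ} {g : α → ℕ} (e : ℕ) (hC : Poly C)
    (hU : Poly U) (hg : Poly g) : Poly (fun a => evalAt e (C a) (U a) (g a)) := by
  have key : Poly (fun p : (BoolCircuit × List ℕ) × ℕ =>
      BoolCircuit.evalAt e p.1.1 p.1.2 p.2) := by
    induction e with
    | zero => exact (snd.comp fst).contains snd
    | succ e ih =>
      have hG : Poly (fun p : (BoolCircuit × List ℕ) × ℕ => p.1.1.gate p.2) :=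
        (fst.comp fst).gate snd
      have ih' : Poly (fun p : ((BoolCircuit × List ℕ) × ℕ) × ℕ =>
        BoolCircuit.evalAt e p.1.1.1 p.1.1.2 p.2) := ih.comp ((fst.comp fst).pair snd)
      convert hG.ite_tag (n := 0) ((snd.comp fst).contains snd) (hG.ite_tag (n := 1)
        (ih.comp (fst.pair (hG.args.headD (const 0)))).not (hG.ite_tag (n := 2)
          (all (F := fun p a => BoolCircuit.evalAt e p.1.1 p.1.2 a) ih' hG.args)
          (any (F := fun p a => BoolCircuit.evalAt e p.1.1 p.1.2 a) ih' hG.args))) using 2 with p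
      rw [BoolCircuit.evalAt]
      cases p.1.1.gate p.2 <;> simp [BoolGate.tag, BoolGate.args]
  exact key.comp ((hC.pair hU).pair hg)

theorem support {C : α → BoolCircuit} {g : α → ℕ} (e : ℕ) (hC : Poly C) (hg : Poly g) :
    Poly (fun a => support e (C a) (g a)) := by
  have key : Poly (fun p : BoolCircuit × ℕ => BoolCircuit.support e p.1 p.2) := by
    induction e with
    | zero => exact snd.cons (const [])
    | succ e ih =>
      have hG : Poly (fun p : BoolCircuit × ℕ => p.1.gate p.2) := fst.gate snd
      convert hG.ite_tag (n := 0) (snd.cons (const [])) (flatMap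
        (F := fun p a => BoolCircuit.support e p.1 a) (ih.comp ((fst.comp fst).pair snd))
        hG.args) using 2 with p
      rw [BoolCircuit.support]
      cases p.1.gate p.2 <;> simp [BoolGate.tag]
  exact key.comp (hC.pair hg)

theorem pairwiseAppend {β : Type*} [Enc β] {L L' : α → List (List β)} (hL : Poly L)
    (hL' : Poly L') : Poly (fun a => pairwiseAppend (L a) (L' a)) :=
  flatMap (F := fun a u => (L' a).map fun v => u ++ v)
    (map (F := fun p v => p.2 ++ v) ((snd.comp fst).append snd) (hL'.comp fst)) hL

theorem altsAll {D : α → ℕ → List (List (ℕ × Bool))} {l : α → List ℕ} {b : α → Bool}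
    (hD : Poly fun p : α × ℕ => D p.1 p.2) (hl : Poly l) (hb : Poly b) :
    Poly (fun a => altsAll (D a) (l a) (b a)) := by
  have h : Poly (fun a => (l a).headD 0) := hl.headD (const 0)
  have := ((const 2).decide_lt hl.length).ite
    ((map (F := fun a i => (i, b a)) (snd.pair (hb.comp fst)) hl).cons (const []))
    ((hD.comp (id.pair h)).pairwiseAppend (hD.comp (id.pair (hl.getD (const 1) h))))
  simpa only [decide_eq_true_eq, BoolCircuit.altsAll] using this

theorem altsAny {D : α → ℕ → List (List (ℕ × Bool))} {l : α → List ℕ} {b : α → Bool}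
    (hD : Poly fun p : α × ℕ => D p.1 p.2) (hl : Poly l) (hb : Poly b) :
    Poly (fun a => altsAny (D a) (l a) (b a)) := by
  have := ((const 2).decide_lt hl.length).ite
    (map (F := fun a i => [(i, b a)]) ((snd.pair (hb.comp fst)).cons (const [])) hl)
    (flatMap (F := D) hD hl)
  simpa only [decide_eq_true_eq, BoolCircuit.altsAny] using this

theorem alts {C : α → BoolCircuit} {g : α → ℕ} {b : α → Bool} (e : ℕ) (hC : Poly C) (hg : Poly g)
    (hb : Poly b) : Poly (fun a => alts e (C a) (g a) (b a)) := by
  have key : Poly (fun p : BoolCircuit × ℕ × Bool => BoolCircuit.alts e p.1 p.2.1 p.2.2) := by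
    induction e with
    | zero => exact (snd.cons (const [])).cons (const [])
    | succ e ih =>
      have hG : Poly (fun p : BoolCircuit × ℕ × Bool => p.1.gate p.2.1) :=
        fst.gate (fst.comp snd)
      have hb : Poly (fun p : BoolCircuit × ℕ × Bool => p.2.2) := snd.comp snd
      have hD : Poly (fun p : (BoolCircuit × ℕ × Bool) × ℕ =>
          BoolCircuit.alts e p.1.1 p.2 p.1.2.2) :=
        ih.comp ((fst.comp fst).pair (snd.pair (hb.comp fst)))
      have h₁ := altsAll (D := fun p a => BoolCircuit.alts e p.1 a p.2.2) hD hG.args hb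
      have h₂ := altsAny (D := fun p a => BoolCircuit.alts e p.1 a p.2.2) hD hG.args hb
      convert hG.ite_tag (n := 0) ((snd.cons (const [])).cons (const [])) (hG.ite_tag (n := 1)
        (ih.comp (fst.pair ((hG.args.headD (const 0)).pair hb.not))) (hG.ite_tag (n := 2)
          (hb.ite h₁ h₂) (hb.ite h₂ h₁))) using 2 with p
      rw [BoolCircuit.alts]
      cases p.1.gate p.2.1 <;> simp [BoolGate.tag, BoolGate.args]
  exact key.comp (hC.pair (hg.pair hb))

end Poly

end

/-! ### Partial assignments and their compatibility -/

/-- Two partial assignments, as lists of pairs, do not give different values to an index. -/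
def compat (c c' : List (ℕ × ℕ)) : Bool :=
  c.all fun p => c'.all fun r => !(decide (p.1 = r.1)) || decide (p.2 = r.2)

theorem compat_iff {c c' : List (ℕ × ℕ)} :
    compat c c' = true ↔ ∀ p ∈ c, ∀ r ∈ c', p.1 = r.1 → p.2 = r.2 := by
  simp only [compat, List.all_eq_true, Bool.or_eq_true, Bool.not_eq_true', decide_eq_true_eq,
    decide_eq_false_iff_not, ← imp_iff_not_or]

theorem compat_comm {c c' : List (ℕ × ℕ)} (h : compat c c' = true) : compat c' c = true := by
  rw [compat_iff] at *
  exact fun p hp r hr e => (h r hr p hp e.symm).symm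

/-- One can choose one partial assignment from each of the lists such that the choices are
pairwise compatible. -/
def HasCompatChoice (Ls : List (List (List (ℕ × ℕ)))) : Prop :=
  ∃ c : ℕ → List (ℕ × ℕ), (∀ α < Ls.length, c α ∈ Ls.getD α []) ∧
    ∀ α β, α < β → β < Ls.length → compat (c α) (c β) = true

/-- Positions in the list are traded for its elements, so that choices can be indexed by tuples. -/
theorem hasCompatChoice_map {ι : Type*} [DecidableEq ι] {l : List ι} (hl : l.Nodup)
    (F : ι → List (List (ℕ × ℕ))) :
    HasCompatChoice (l.map F) ↔ ∃ c : ι → List (ℕ × ℕ), (∀ I ∈ l, c I ∈ F I) ∧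
      ∀ I ∈ l, ∀ J ∈ l, I ≠ J → compat (c I) (c J) = true := by
  constructor
  · rintro ⟨c, h₁, h₂⟩
    refine ⟨fun I => c (l.idxOf I), fun I hI => ?_, fun I hI J hJ hne => ?_⟩
    · have h := List.idxOf_lt_length_of_mem hI
      simpa [h] using h₁ (l.idxOf I) (by simpa using h)
    · have hi := List.idxOf_lt_length_of_mem hI
      have hj := List.idxOf_lt_length_of_mem hJ
      have hne : l.idxOf I ≠ l.idxOf J := fun h => hne ((List.idxOf_inj hI).1 h)
      rcases lt_or_gt_of_ne hne with h | h
      · exact h₂ _ _ h (by simpa using hj)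
      · exact compat_comm (h₂ _ _ h (by simpa using hi))
  · rintro ⟨c, h₁, h₂⟩
    refine ⟨fun α => if h : α < l.length then c l[α] else [], fun α h => ?_, fun α β h hβ => ?_⟩
    · have h : α < l.length := by simpa using h
      simpa [h] using h₁ _ (List.getElem_mem h)
    · have hβ : β < l.length := by simpa using hβ
      have hα : α < l.length := h.trans hβ
      simp only [hα, hβ, dif_pos]
      exact h₂ _ (List.getElem_mem _) _ (List.getElem_mem _) fun e =>
        h.ne ((hl.getElem_inj_iff).1 e)

/-! ### Enumeration of small hitting sets -/

/-- `A` and `P` have a common element. -/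
def hits (A P : List (ℕ × ℕ)) : Bool :=
  P.any fun p => A.any fun r => decide (p.1 = r.1) && decide (p.2 = r.2)

theorem hits_iff {A P : List (ℕ × ℕ)} : hits A P = true ↔ ∃ p ∈ P, p ∈ A := by
  simp only [hits, List.any_eq_true, Bool.and_eq_true, decide_eq_true_eq]
  constructor
  · rintro ⟨p, hp, r, hr, h₁, h₂⟩
    exact ⟨p, hp, by rwa [Prod.ext h₁ h₂]⟩
  · rintro ⟨p, hp, h⟩
    exact ⟨p, hp, p, h, rfl, rfl⟩

/-- Extend `A` in all possible ways by an element of the first set that it does not hit. -/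
def expand (H : List (List (ℕ × ℕ))) (A : List (ℕ × ℕ)) : List (List (ℕ × ℕ)) :=
  if (H.filter fun P => !(hits A P)).isEmpty = true then [A]
  else ((H.filter fun P => !(hits A P)).headD []).map fun p => p :: A

/-- The nodes of level `i` of the search tree for hitting sets, but at most `N` of them. -/
def searchLevel (H : List (List (ℕ × ℕ))) (N i : ℕ) : List (List (ℕ × ℕ)) :=
  (fun L => (L.flatMap (expand H)).take N)^[i] [[]]

/-- Sets that hit all members of `H`. -/
def hittingSets (H : List (List (ℕ × ℕ))) (N m : ℕ) : List (List (ℕ × ℕ)) :=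
  (searchLevel H N m).filter fun A => H.all (hits A)

theorem searchLevel_succ (H : List (List (ℕ × ℕ))) (N i : ℕ) :
    searchLevel H N (i + 1) = ((searchLevel H N i).flatMap (expand H)).take N :=
  Function.iterate_succ_apply' _ _ _

theorem expand_cases (H : List (List (ℕ × ℕ))) (A : List (ℕ × ℕ)) :
    (expand H A = [A] ∧ ∀ P ∈ H, hits A P = true) ∨
      ∃ P ∈ H, hits A P = false ∧ expand H A = P.map fun p => p :: A := by
  rw [expand]
  cases h : H.filter fun P => !(hits A P) with
  | nil =>
    left
    rw [List.filter_eq_nil_iff] at h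
    simpa using h
  | cons P l =>
    right
    have hP : P ∈ H.filter fun P => !(hits A P) := by simp [h]
    rw [List.mem_filter] at hP
    exact ⟨P, hP.1, by simpa using hP.2, by simp⟩

theorem mem_hittingSets {H : List (List (ℕ × ℕ))} {N m : ℕ} {A : List (ℕ × ℕ)}
    (hA : A ∈ hittingSets H N m) {P : List (ℕ × ℕ)} (hP : P ∈ H) : ∃ p ∈ P, p ∈ A := by
  rw [hittingSets, List.mem_filter, List.all_eq_true] at hA
  exact hits_iff.1 (hA.2 P hP)

/-- Follow the branch of the search tree that always adds an element of `S`. An added element is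
new, because the set it comes from was not hit. After `m ≥ S.card` levels either everything is hit
or `A` exhausts `S`, which hits everything. Level `i` has at most `B ^ i` nodes, so the cut-off `N`
discards nothing. -/
theorem exists_hittingSet {H : List (List (ℕ × ℕ))} {N m B : ℕ} {S : Finset (ℕ × ℕ)}
    (hS : S.card ≤ m) (hH : ∀ P ∈ H, ∃ p ∈ P, p ∈ S) (hB : ∀ P ∈ H, P.length ≤ B)
    (hB₁ : 1 ≤ B) (hN : B ^ m ≤ N) : ∃ A ∈ hittingSets H N m, ∀ p ∈ A, p ∈ S := by
  have hlen : ∀ A, (expand H A).length ≤ B := by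
    intro A
    rcases expand_cases H A with ⟨h, _⟩ | ⟨P, hP, _, h⟩
    · simpa [h] using hB₁
    · simpa [h] using hB P hP
  have key : ∀ i ≤ m, (searchLevel H N i).length ≤ B ^ i ∧ ∃ A ∈ searchLevel H N i,
      (∀ p ∈ A, p ∈ S) ∧ A.Nodup ∧ ((∀ P ∈ H, hits A P = true) ∨ A.length = i) := by
    intro i
    induction i with
    | zero => intro _; exact ⟨by simp [searchLevel], [], by simp [searchLevel], by simp⟩
    | succ i ih =>
      intro hi
      obtain ⟨hl, A, hA, hAS, hnd, hA'⟩ := ih (by omega)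
      have h₁ : ((searchLevel H N i).flatMap (expand H)).length ≤ B ^ (i + 1) := by
        rw [List.length_flatMap]
        refine (List.sum_le_card_nsmul _ B fun x hx => ?_).trans ?_
        · obtain ⟨A, _, rfl⟩ := List.mem_map.1 hx
          exact hlen A
        · rw [List.length_map, smul_eq_mul, pow_succ]
          exact Nat.mul_le_mul hl le_rfl
      have h₂ : searchLevel H N (i + 1) = (searchLevel H N i).flatMap (expand H) := by
        rw [searchLevel_succ, List.take_of_length_le]
        exact h₁.trans ((Nat.pow_le_pow_right hB₁ hi).trans hN)
      rw [h₂]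
      refine ⟨h₁, ?_⟩
      rcases expand_cases H A with ⟨h, hh⟩ | ⟨P, hP, hh, h⟩
      · exact ⟨A, List.mem_flatMap.2 ⟨A, hA, by simp [h]⟩, hAS, hnd, Or.inl hh⟩
      · obtain ⟨p, hp, hpS⟩ := hH P hP
        refine ⟨p :: A, List.mem_flatMap.2 ⟨A, hA, ?_⟩, ?_, ?_, Or.inr ?_⟩
        · rw [h]; exact List.mem_map_of_mem hp
        · simpa [hpS] using fun a b h => hAS (a, b) h
        · refine List.nodup_cons.2 ⟨fun hpA => ?_, hnd⟩
          rw [hits_iff.2 ⟨p, hp, hpA⟩] at hh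
          simp at hh
        · rcases hA' with hA' | hA'
          · rw [hA' P hP] at hh; simp at hh
          · simp [hA']
  obtain ⟨_, A, hA, hAS, hnd, hA'⟩ := key m le_rfl
  refine ⟨A, List.mem_filter.2 ⟨hA, List.all_eq_true.2 fun P hP => ?_⟩, hAS⟩
  rcases hA' with hA' | hA'
  · exact hA' P hP
  · have h₁ : A.toFinset ⊆ S := fun p hp => hAS p (List.mem_toFinset.1 hp)
    have h₂ : A.toFinset = S := Finset.eq_of_subset_of_card_le h₁ (by
      rw [List.toFinset_card_of_nodup hnd]; omega)
    obtain ⟨p, hp, hpS⟩ := hH P hP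
    exact hits_iff.2 ⟨p, hp, by rwa [← List.mem_toFinset, h₂]⟩

/-! ### Tuples -/

/-- All lists of length `q` of numbers below `n`. -/
def tuples (n : ℕ) : ℕ → List (List ℕ)
  | 0 => [[]]
  | q + 1 => (List.range n).flatMap fun i => (tuples n q).map fun I => i :: I

theorem mem_tuples {n q : ℕ} {I : List ℕ} : I ∈ tuples n q ↔ I.length = q ∧ ∀ i ∈ I, i < n := by
  induction q generalizing I with
  | zero => cases I <;> simp [tuples]
  | succ q ih =>
    simp only [tuples, List.mem_flatMap, List.mem_range, List.mem_map, ih]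
    constructor
    · rintro ⟨i, hi, J, ⟨h₁, h₂⟩, rfl⟩
      simpa [h₁, hi] using h₂
    · rintro ⟨h₁, h₂⟩
      cases I with
      | nil => simp at h₁
      | cons i J => exact ⟨i, h₂ i (by simp), J, ⟨by simpa using h₁, fun j hj => h₂ j (by simp [hj])⟩,
          rfl⟩

theorem length_tuples (n q : ℕ) : (tuples n q).length = n ^ q := by
  induction q with
  | zero => rfl
  | succ q ih => simp [tuples, ih, pow_succ, mul_comm]

theorem nodup_tuples (n q : ℕ) : (tuples n q).Nodup := by
  induction q with
  | zero => simp [tuples]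
  | succ q ih =>
    rw [tuples, List.nodup_flatMap]
    refine ⟨fun i _ => ih.map fun a b h => (List.cons.inj h).2, ?_⟩
    refine List.nodup_range.imp fun {i j} hij => ?_
    simp only [Function.onFun, List.disjoint_left, List.mem_map]
    rintro _ ⟨I, _, rfl⟩ ⟨J, _, h⟩
    exact hij (List.cons.inj h).1.symm

/-- The pairs of corresponding entries. -/
def graphOf (I U : List ℕ) : List (ℕ × ℕ) :=
  (List.range I.length).map fun r => (I.getD r 0, U.getD r 0)

theorem mem_graphOf_map {I : List ℕ} {t : ℕ → ℕ} {p : ℕ × ℕ} :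
    p ∈ graphOf I (I.map t) ↔ p.1 ∈ I ∧ p.2 = t p.1 := by
  simp only [graphOf, List.mem_map, List.mem_range]
  constructor
  · rintro ⟨r, hr, rfl⟩
    simp [hr]
  · rintro ⟨h₁, h₂⟩
    obtain ⟨r, hr, h⟩ := List.getElem_of_mem h₁
    exact ⟨r, hr, by ext <;> simp [hr, h, h₂]⟩

theorem eq_map_of_graphOf {I U : List ℕ} {t : ℕ → ℕ} (hl : U.length = I.length)
    (h : ∀ p ∈ graphOf I U, p.2 = t p.1) : U = I.map t := by
  refine List.ext_getElem (by simpa using hl) fun r h₁ h₂ => ?_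
  have hr : r < I.length := by omega
  have := h (I.getD r 0, U.getD r 0) (List.mem_map.2 ⟨r, by simpa using hr, rfl⟩)
  simpa [hr, h₁] using this

/-! ### From weighted satisfiability to compatible choices -/

namespace BoolCircuit

/-- The sets that have to be hit by the true inputs outside `U` if the prescriptions `w` are met:
for each gate that has a wrong value when exactly the inputs in `U` are true, the other inputs on
which it depends. Each input is paired with all possible indices. -/
def obstacles (d q : ℕ) (C : BoolCircuit) (k : ℕ) (w : List (ℕ × Bool)) (U : List ℕ) :
    List (List (ℕ × ℕ)) :=
  (w.filter fun p => !(evalAt d C U p.1 == p.2)).map fun p =>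
    (((support d C p.1).filter fun a => !(decide (a ∈ U))).take q).flatMap fun a =>
      (List.range (k + 2)).map fun i => (i, a)

/-- The indices below `k` stand for inputs, and the others for fixed numbers that are not gates. -/
def legal (C : BoolCircuit) (k : ℕ) (p : ℕ × ℕ) : Bool :=
  if decide (p.1 < k) = true then decide (p.2 < C.length) && decide ((C.gate p.2).tag = 0)
  else decide (p.2 = C.length + p.1)

/-- All entries are legal, and different indices have different values. -/
def valid (C : BoolCircuit) (k : ℕ) (z : List (ℕ × ℕ)) : Bool :=
  z.all (C.legal k) && z.all fun p => z.all fun r => !(decide (p.2 = r.2)) || decide (p.1 = r.1)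

/-- Partial assignments for the indices in `I`, for the index `k + 2`, which stands for the
alternative of the normal form that is satisfied, and for a hitting set. -/
def contents (d q : ℕ) (C : BoolCircuit) (k N : ℕ) (I : List ℕ) : List (List (ℕ × ℕ)) :=
  (List.range (alts d C (C.length - 1) true).length).flatMap fun ω =>
    (tuples (C.length + (k + 2)) q).flatMap fun U =>
      if C.valid k (graphOf I U) = true then
        ((hittingSets (obstacles d q C k ((alts d C (C.length - 1) true).getD ω []) U) N
          (k + 2)).map fun A => (k + 2, ω) :: (graphOf I U ++ A)).filter fun c => compat c c
      else []

/-- The lists of partial assignments for all `q`-tuples of indices. -/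
def choiceLists (d q : ℕ) (C : BoolCircuit) (k N : ℕ) : List (List (List (ℕ × ℕ))) :=
  (tuples (k + 2) q).map (contents d q C k N)

theorem tag_eq_zero {G : BoolGate} : G.tag = 0 ↔ G = .input := by
  cases G <;> simp [BoolGate.tag]

theorem legal_of_lt {C : BoolCircuit} {k i a : ℕ} (hi : i < k) :
    C.legal k (i, a) = true ↔ C[a]? = some .input := by
  simp only [legal, hi, decide_true, if_true, Bool.and_eq_true, decide_eq_true_eq, tag_eq_zero,
    List.getElem?_eq_some_iff]
  exact ⟨fun h => ⟨h.1, by rw [← gate_eq h.1, h.2]⟩, fun ⟨h, h'⟩ => ⟨h, by rw [gate_eq h, h']⟩⟩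

theorem legal_of_le {C : BoolCircuit} {k i a : ℕ} (hi : k ≤ i) :
    C.legal k (i, a) = true ↔ a = C.length + i := by
  simp [legal, hi.not_gt]

theorem valid_iff {C : BoolCircuit} {k : ℕ} {z : List (ℕ × ℕ)} : C.valid k z = true ↔
    (∀ p ∈ z, C.legal k p = true) ∧ ∀ p ∈ z, ∀ r ∈ z, p.2 = r.2 → p.1 = r.1 := by
  simp only [valid, Bool.and_eq_true, List.all_eq_true, Bool.or_eq_true, Bool.not_eq_true',
    decide_eq_true_eq, decide_eq_false_iff_not, ← imp_iff_not_or]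

theorem mem_contents {d q : ℕ} {C : BoolCircuit} {k N : ℕ} {I : List ℕ} {c : List (ℕ × ℕ)} :
    c ∈ contents d q C k N I ↔ ∃ ω < (alts d C (C.length - 1) true).length,
      ∃ U ∈ tuples (C.length + (k + 2)) q, C.valid k (graphOf I U) = true ∧
      ∃ A ∈ hittingSets (obstacles d q C k ((alts d C (C.length - 1) true).getD ω []) U) N (k + 2),
        (k + 2, ω) :: (graphOf I U ++ A) = c ∧ compat c c = true := by
  simp only [contents, List.mem_flatMap, List.mem_range]
  refine exists_congr fun ω => and_congr_right fun _ => exists_congr fun U =>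
    and_congr_right fun _ => ?_
  split_ifs with h
  · simp only [List.mem_filter, List.mem_map, h, true_and]
    constructor
    · rintro ⟨⟨A, hA, rfl⟩, h⟩; exact ⟨A, hA, rfl, h⟩
    · rintro ⟨A, hA, rfl, h⟩; exact ⟨⟨A, hA, rfl⟩, h⟩
  · simp [h]

theorem mem_obstacles {d q : ℕ} {C : BoolCircuit} {k : ℕ} {w : List (ℕ × Bool)} {U : List ℕ}
    {P : List (ℕ × ℕ)} : P ∈ obstacles d q C k w U ↔ ∃ p ∈ w, evalAt d C U p.1 ≠ p.2 ∧
      (((support d C p.1).filter fun a => !(decide (a ∈ U))).take q).flatMap (fun a =>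
        (List.range (k + 2)).map fun i => (i, a)) = P := by
  simp only [obstacles, List.mem_map, List.mem_filter, Bool.not_eq_true', beq_eq_false_iff_ne,
    and_assoc]

section

variable {d q : ℕ} {C : BoolCircuit} {k N : ℕ}

/-- Compatibility glues the choices to one map `t` and one alternative `w`. Every prescription of
`w` is then checked at the tuple made for the support of its gate. -/
theorem WellFormed.weightedSat_of_choice (hC : C.WellFormed) (hw : C.weft ≤ 1) (hd : C.depth ≤ d)
    (hq : 2 ≤ q) (hqd : 2 ^ d ≤ q) {c : List ℕ → List (ℕ × ℕ)}
    (hc : ∀ I ∈ tuples (k + 2) q, c I ∈ contents d q C k N I)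
    (hcc : ∀ I ∈ tuples (k + 2) q, ∀ J ∈ tuples (k + 2) q, I ≠ J → compat (c I) (c J) = true) :
    C.WeightedSat k := by
  have hlen : C.length - 1 < C.length := by
    have := List.length_pos_of_ne_nil hC.nonempty; omega
  simp only [mem_contents] at hc
  choose! ω hω U hU hV A hA hcA hself using hc
  replace hcc : ∀ I ∈ tuples (k + 2) q, ∀ J ∈ tuples (k + 2) q, ∀ p ∈ c I, ∀ r ∈ c J,
      p.1 = r.1 → p.2 = r.2 := by
    intro I hI J hJ
    rw [← compat_iff]
    by_cases h : I = J
    · exact h ▸ hself I hI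
    · exact hcc I hI J hJ h
  have hrep : ∀ i < k + 2, List.replicate q i ∈ tuples (k + 2) q := fun i hi =>
    mem_tuples.2 ⟨by simp, fun j hj => by rw [List.eq_of_mem_replicate hj]; exact hi⟩
  -- The value of `i` is read off at the constant tuple; compatibility forces all other choices to
  -- agree with it.
  set t : ℕ → ℕ := fun i => (U (List.replicate q i)).getD 0 0 with ht
  have ht_mem : ∀ i < k + 2, (i, t i) ∈ graphOf (List.replicate q i) (U (List.replicate q i)) := by
    intro i _
    refine List.mem_map.2 ⟨0, by simp; omega, ?_⟩
    ext
    · rw [List.getD_eq_getElem _ _ (by simp; omega)]; simp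
    · rfl
  have hgraph : ∀ I ∈ tuples (k + 2) q, ∀ p ∈ graphOf I (U I), p ∈ c I := fun I hI p hp => by
    rw [← hcA I hI]; simp [hp]
  have hc_eq : ∀ I ∈ tuples (k + 2) q, ∀ p ∈ c I, p.1 < k + 2 → p.2 = t p.1 := by
    intro I hI p hp hlt
    exact hcc I hI _ (hrep _ hlt) p hp _ (hgraph _ (hrep _ hlt) _ (ht_mem _ hlt)) rfl
  have hlt_of_mem : ∀ I ∈ tuples (k + 2) q, ∀ p ∈ graphOf I (U I), p.1 < k + 2 := by
    intro I hI p hp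
    obtain ⟨r, hr, rfl⟩ := List.mem_map.1 hp
    have hr := List.mem_range.1 hr
    simp only [List.getD_eq_getElem _ _ hr]
    exact (mem_tuples.1 hI).2 _ (List.getElem_mem _)
  have hU_eq : ∀ I ∈ tuples (k + 2) q, U I = I.map t := fun I hI =>
    eq_map_of_graphOf ((mem_tuples.1 (hU I hI)).1.trans (mem_tuples.1 hI).1.symm) fun p hp =>
      hc_eq I hI p (hgraph I hI p hp) (hlt_of_mem I hI p hp)
  have hV' : ∀ I ∈ tuples (k + 2) q, C.valid k (graphOf I (I.map t)) = true := fun I hI => by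
    rw [← hU_eq I hI]; exact hV I hI
  simp only [valid_iff] at hV'
  have hlegal : ∀ i < k + 2, C.legal k (i, t i) = true := fun i hi =>
    (hV' _ (hrep i hi)).1 _ (mem_graphOf_map.2 ⟨by simp; omega, rfl⟩)
  have hinj : ∀ i < k + 2, ∀ j < k + 2, t i = t j → i = j := by
    intro i hi j hj h
    -- Validity compares entries of a single tuple, so a tuple containing both indices is needed;
    -- this is where `2 ≤ q` enters.
    have hI : i :: j :: List.replicate (q - 2) i ∈ tuples (k + 2) q := by
      refine mem_tuples.2 ⟨by simp; omega, ?_⟩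
      simp only [List.mem_cons, List.mem_replicate]
      rintro x (rfl | rfl | ⟨_, rfl⟩) <;> assumption
    exact (hV' _ hI).2 (i, t i) (mem_graphOf_map.2 ⟨by simp, rfl⟩) (j, t j)
      (mem_graphOf_map.2 ⟨by simp, rfl⟩) h
  -- The index `k + 2` carries the alternative, so compatibility makes it the same everywhere.
  have hω_eq : ∀ I ∈ tuples (k + 2) q, ω I = ω (List.replicate q 0) := fun I hI =>
    hcc I hI _ (hrep 0 (by omega)) (k + 2, ω I) (by rw [← hcA I hI]; simp)
      (k + 2, ω (List.replicate q 0)) (by rw [← hcA _ (hrep 0 (by omega))]; simp) rfl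
  have hinput : ∀ i < k, C[t i]? = some .input := fun i hi =>
    (legal_of_lt hi).1 (hlegal i (by omega))
  have hdummy : ∀ i < k + 2, k ≤ i → t i = C.length + i := fun i hi h =>
    (legal_of_le h).1 (hlegal i hi)
  set w := (alts d C (C.length - 1) true).getD (ω (List.replicate q 0)) [] with hwdef
  have hw_mem : w ∈ alts d C (C.length - 1) true := by
    rw [hwdef, List.getD_eq_getElem _ _ (hω _ (hrep 0 (by omega)))]
    exact List.getElem_mem _
  refine ⟨(Finset.range k).image t, ?_, ?_, ?_⟩
  · intro a ha
    obtain ⟨i, hi, rfl⟩ := Finset.mem_image.1 ha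
    exact hinput i (Finset.mem_range.1 hi)
  · rw [Finset.card_image_of_injOn, Finset.card_range]
    intro i hi j hj h
    simp only [Finset.coe_range, Set.mem_Iio] at hi hj
    exact hinj i (by omega) j (by omega) h
  · rw [eval_eq_val, ← hC.exists_alts _ d hlen]
    refine ⟨w, hw_mem, ?_⟩
    intro p hp
    obtain ⟨hp₁, hp₂, hp₃⟩ := hC.weftAt_of_mem_alts (d := d) hlen (by rwa [← weft_eq_weftAt])
      (by rwa [← depth_eq_depthAt]) (by rwa [← depth_eq_depthAt]) hw_mem hp
    rw [← hC.evalAt_eq_val ((Finset.range k).image t) ((List.range k).map t) (by simp) d hp₁ hp₃]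
    -- These indices fit into one tuple because `t` is injective and the support has at most `2 ^ d
    -- ≤ q` elements.
    set S := (List.range k).filter fun i => decide (t i ∈ support d C p.1) with hS
    have hS_mem : ∀ i, i ∈ S ↔ i < k ∧ t i ∈ support d C p.1 := by simp [hS]
    have hS_len : S.length ≤ q := by
      have hnd : (S.map t).Nodup := by
        refine List.Nodup.map_on ?_ (List.nodup_range.filter _)
        intro i hi j hj h
        rw [hS_mem] at hi hj
        exact hinj i (by omega) j (by omega) h
      have hsub : S.map t ⊆ support d C p.1 := by
        intro a ha
        obtain ⟨i, hi, rfl⟩ := List.mem_map.1 ha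
        exact ((hS_mem i).1 hi).2
      have := (List.subperm_of_subset hnd hsub).length_le
      rw [List.length_map] at this
      exact this.trans ((hC.length_support_le hp₁ hp₂).trans hqd)
    -- The value of the padding index `k` is not a gate, so it adds no input of the support.
    set I := S ++ List.replicate (q - S.length) k with hI
    have hI_mem : I ∈ tuples (k + 2) q := by
      refine mem_tuples.2 ⟨by simp [hI]; omega, fun i hi => ?_⟩
      rcases List.mem_append.1 hi with hi | hi
      · have := (hS_mem i).1 hi; omega
      · rw [List.eq_of_mem_replicate hi]; omega
    have hUT : ∀ a ∈ support d C p.1, a ∈ U I ↔ a ∈ (List.range k).map t := by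
      intro a ha
      have hlt := hC.lt_of_mem_support hp₁ ha
      rw [hU_eq I hI_mem, List.mem_map, List.mem_map]
      constructor
      · rintro ⟨i, hi, rfl⟩
        rcases List.mem_append.1 hi with hi | hi
        · exact ⟨i, by simpa using ((hS_mem i).1 hi).1, rfl⟩
        · rw [List.eq_of_mem_replicate hi, hdummy k (by omega) le_rfl] at hlt
          omega
      · rintro ⟨i, hi, rfl⟩
        exact ⟨i, List.mem_append_left _ ((hS_mem i).2 ⟨by simpa using hi, ha⟩), rfl⟩
    rw [← evalAt_congr hUT]
    by_contra hne
    have hob : _ ∈ obstacles d q C k ((alts d C (C.length - 1) true).getD (ω I) []) (U I) :=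
      mem_obstacles.2 ⟨p, by rw [hω_eq I hI_mem]; exact hp, hne, rfl⟩
    -- The named input is a value of `t` in the support. Being a gate, it belongs to an index below
    -- `k`, hence to `S`, although it was taken outside `U I`.
    obtain ⟨⟨j, a⟩, hr, hrA⟩ := mem_hittingSets (hA I hI_mem) hob
    obtain ⟨a', ha', hia⟩ := List.mem_flatMap.1 hr
    simp only [List.mem_map, List.mem_range, Prod.mk.injEq] at hia
    obtain ⟨i, hi, rfl, rfl⟩ := hia
    have ha' := List.mem_filter.1 (List.mem_of_mem_take ha')
    have hat : a' = t i := hc_eq I hI_mem (i, a') (by rw [← hcA I hI_mem]; simp [hrA]) hi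
    have hlt := hC.lt_of_mem_support hp₁ ha'.1
    have hik : i < k := by
      by_contra hik
      have := hdummy i hi (by omega)
      omega
    have hnU : a' ∉ U I := by simpa using ha'.2
    rw [hUT a' ha'.1] at hnU
    exact hnU (List.mem_map.2 ⟨i, by simpa using hik, hat.symm⟩)

/-- All choices are restrictions of a single function, built from an enumeration `t` of `T` and the
index of a satisfied alternative. -/
theorem WellFormed.choice_of_weightedSat (hC : C.WellFormed) (hw : C.weft ≤ 1) (hd : C.depth ≤ d)
    (hq : 1 ≤ q) (hqd : 2 ^ d ≤ q) (hN : (q * (k + 2)) ^ (k + 2) ≤ N) (h : C.WeightedSat k) :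
    ∃ c : List ℕ → List (ℕ × ℕ), (∀ I ∈ tuples (k + 2) q, c I ∈ contents d q C k N I) ∧
      ∀ I ∈ tuples (k + 2) q, ∀ J ∈ tuples (k + 2) q, I ≠ J → compat (c I) (c J) = true := by
  have hlen : C.length - 1 < C.length := by
    have := List.length_pos_of_ne_nil hC.nonempty; omega
  obtain ⟨T, hT, hTk, hev⟩ := h
  rw [eval_eq_val, ← hC.exists_alts _ d hlen] at hev
  obtain ⟨w, hw_mem, hmeets⟩ := hev
  obtain ⟨ω, hω, hω'⟩ := List.getElem_of_mem hw_mem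
  have hTlen : T.toList.length = k := by simpa using hTk
  have hTlt : ∀ a ∈ T, a < C.length := fun a ha => (List.getElem?_eq_some_iff.1 (hT a ha)).1
  set t : ℕ → ℕ := fun i => if i < k then T.toList.getD i 0 else C.length + i with ht
  have ht_lt : ∀ i < k, t i ∈ T := by
    intro i hi
    simp only [ht, if_pos hi, List.getD_eq_getElem _ _ (hTlen.symm ▸ hi)]
    exact Finset.mem_toList.1 (List.getElem_mem _)
  have ht_ge : ∀ i, k ≤ i → t i = C.length + i := fun i hi => by simp [ht, hi.not_gt]
  have ht_surj : ∀ a ∈ T, ∃ i < k, t i = a := by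
    intro a ha
    obtain ⟨i, hi, h⟩ := List.getElem_of_mem (Finset.mem_toList.2 ha)
    refine ⟨i, by omega, ?_⟩
    simp only [ht, if_pos (show i < k by omega), List.getD_eq_getElem _ _ hi, h]
  have hlegal : ∀ i, C.legal k (i, t i) = true := by
    intro i
    rcases Nat.lt_or_ge i k with hi | hi
    · exact (legal_of_lt hi).2 (hT _ (ht_lt i hi))
    · exact (legal_of_le hi).2 (ht_ge i hi)
  have hinj : ∀ i j, t i = t j → i = j := by
    intro i j hij
    rcases Nat.lt_or_ge i k with hi | hi <;> rcases Nat.lt_or_ge j k with hj | hj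
    · simp only [ht, if_pos hi, if_pos hj, List.getD_eq_getElem _ _ (hTlen.symm ▸ hi),
        List.getD_eq_getElem _ _ (hTlen.symm ▸ hj)] at hij
      exact (T.nodup_toList.getElem_inj_iff).1 hij
    · have := hTlt _ (ht_lt i hi)
      rw [ht_ge j hj] at hij; omega
    · have := hTlt _ (ht_lt j hj)
      rw [ht_ge i hi] at hij; omega
    · rw [ht_ge i hi, ht_ge j hj] at hij; omega
  have key : ∀ I ∈ tuples (k + 2) q, ∃ c ∈ contents d q C k N I,
      ∀ p ∈ c, p.2 = if p.1 < k + 2 then t p.1 else ω := by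
    intro I hI
    have hI' := mem_tuples.1 hI
    -- The graph of `t` hits every obstacle: a gate that is right for `T` but wrong for the tuple
    -- depends on an input on which the two differ. Since the gates among the values of the tuple
    -- all lie in `T`, that input lies in `T` outside the tuple.
    have hS := exists_hittingSet (H := obstacles d q C k w (I.map t)) (N := N) (m := k + 2)
      (B := q * (k + 2)) (S := (Finset.range (k + 2)).image fun i => (i, t i))
      (Finset.card_image_le.trans (by simp)) (by
        intro P hP
        obtain ⟨p, hp, hne, rfl⟩ := mem_obstacles.1 hP
        obtain ⟨hp₁, hp₂, hp₃⟩ := hC.weftAt_of_mem_alts (d := d) hlen (by rwa [← weft_eq_weftAt])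
          (by rwa [← depth_eq_depthAt]) (by rwa [← depth_eq_depthAt]) hw_mem hp
        have hval := hmeets p hp
        rw [← hC.evalAt_eq_val T T.toList (by simp) d hp₁ hp₃] at hval
        rw [← hval] at hne
        obtain ⟨a, ha, haU⟩ : ∃ a ∈ support d C p.1, ¬(a ∈ I.map t ↔ a ∈ T.toList) := by
          by_contra hcon
          push Not at hcon
          exact hne (evalAt_congr hcon)
        have hlt := hC.lt_of_mem_support hp₁ ha
        have hUT : a ∈ I.map t → a ∈ T := by
          intro h
          obtain ⟨i, hi, rfl⟩ := List.mem_map.1 h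
          rcases Nat.lt_or_ge i k with hik | hik
          · exact ht_lt i hik
          · rw [ht_ge i hik] at hlt; omega
        have ⟨h₁, h₂⟩ : a ∈ T ∧ a ∉ I.map t := by
          rw [Finset.mem_toList] at haU
          tauto
        obtain ⟨i, hi, rfl⟩ := ht_surj a h₁
        refine ⟨(i, t i), List.mem_flatMap.2 ⟨t i, ?_, ?_⟩, ?_⟩
        -- The cut-off at `q` removes nothing, since the support has at most `2 ^ d ≤ q` elements;
        -- its use is the bound `q * (k + 2)` for the branching below.
        · rw [List.take_of_length_le]
          · exact List.mem_filter.2 ⟨ha, by simpa using h₂⟩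
          · exact (List.length_filter_le _ _).trans ((hC.length_support_le hp₁ hp₂).trans hqd)
        · exact List.mem_map.2 ⟨i, by simp; omega, rfl⟩
        · exact Finset.mem_image.2 ⟨i, by simp; omega, rfl⟩)
      (by
        intro P hP
        obtain ⟨p, hp, hne, rfl⟩ := mem_obstacles.1 hP
        rw [List.length_flatMap]
        refine (List.sum_le_card_nsmul _ (k + 2) fun x hx => ?_).trans ?_
        · obtain ⟨A, _, rfl⟩ := List.mem_map.1 hx
          simp
        · rw [List.length_map, smul_eq_mul]
          exact Nat.mul_le_mul (List.length_take_le _ _) le_rfl)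
      (Nat.mul_pos hq (by omega)) hN
    obtain ⟨A, hA, hAS⟩ := hS
    -- The function on the right does not depend on `I`, so this gives all compatibilities at once,
    -- including that of a choice with itself.
    have hfun : ∀ p ∈ (k + 2, ω) :: (graphOf I (I.map t) ++ A),
        p.2 = if p.1 < k + 2 then t p.1 else ω := by
      intro p hp
      rcases List.mem_cons.1 hp with rfl | hp
      · simp
      rcases List.mem_append.1 hp with hp | hp
      · rw [mem_graphOf_map] at hp
        rw [if_pos (hI'.2 _ hp.1), hp.2]
      · obtain ⟨i, hi, rfl⟩ := Finset.mem_image.1 (hAS p hp)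
        rw [if_pos (by simpa using hi)]
    refine ⟨_, mem_contents.2 ⟨ω, hω, I.map t, mem_tuples.2 ⟨by simpa using hI'.1, ?_⟩,
      valid_iff.2 ⟨?_, ?_⟩, A, ?_, rfl, ?_⟩, hfun⟩
    · intro a ha
      obtain ⟨i, hi, rfl⟩ := List.mem_map.1 ha
      have := hI'.2 i hi
      rcases Nat.lt_or_ge i k with hik | hik
      · have := hTlt _ (ht_lt i hik); omega
      · rw [ht_ge i hik]; omega
    · rintro ⟨i, a⟩ hp
      obtain ⟨_, h⟩ := mem_graphOf_map.1 hp
      simp only at h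
      exact h ▸ hlegal i
    · intro p hp r hr h
      rw [(mem_graphOf_map.1 hp).2, (mem_graphOf_map.1 hr).2] at h
      exact hinj _ _ h
    · rwa [List.getD_eq_getElem _ _ hω, hω']
    · rw [compat_iff]
      intro p hp r hr h
      rw [hfun p hp, hfun r hr, h]
  choose! c hc hfun using key
  refine ⟨c, hc, fun I hI J hJ _ => compat_iff.2 fun p hp r hr h => ?_⟩
  rw [hfun I hI p hp, hfun J hJ r hr, h]

theorem WellFormed.hasCompatChoice_iff (hC : C.WellFormed) (hw : C.weft ≤ 1) (hd : C.depth ≤ d)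
    (hq : 2 ≤ q) (hqd : 2 ^ d ≤ q) (hN : (q * (k + 2)) ^ (k + 2) ≤ N) :
    HasCompatChoice (choiceLists d q C k N) ↔ C.WeightedSat k := by
  rw [choiceLists, hasCompatChoice_map (nodup_tuples _ _)]
  exact ⟨fun ⟨_, h₁, h₂⟩ => hC.weightedSat_of_choice hw hd hq hqd h₁ h₂,
    hC.choice_of_weightedSat hw hd (by omega) hqd hN⟩

end

end BoolCircuit

open MvPolynomial

/-! ### Circuits for products of sums of variables -/

namespace ArithCircuit

/-- The number of variables before the `r`-th list. -/
def offset (E : List (List (ℕ × ℕ))) (r : ℕ) : ℕ := (E.take r).flatten.length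

/-- The gate that adds the variables of the `r`-th list. -/
def sumGate (E : List (List (ℕ × ℕ))) (r : ℕ) : ArithGate :=
  .add ((List.range (E.getD r []).length).map fun s => offset E r + s)

/-- The gate that multiplies the first `j + 2` sums. -/
def prodGate (E : List (List (ℕ × ℕ))) (j : ℕ) : ArithGate :=
  .mul (if decide (j = 0) = true then E.flatten.length else E.flatten.length + E.length + (j - 1))
    (E.flatten.length + (j + 1))

/-- A circuit for the product of the sums of the given lists of variables. -/
def prodSum (E : List (List (ℕ × ℕ))) : ArithCircuit :=
  (E.flatten.map fun e => ArithGate.var e.1 e.2) ++ ((List.range E.length).map (sumGate E) ++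
    (List.range (E.length - 1)).map (prodGate E))

theorem length_prodSum (E : List (List (ℕ × ℕ))) :
    (prodSum E).length = E.flatten.length + (E.length + (E.length - 1)) := by
  simp [-List.map_flatten, -List.length_flatten, prodSum]

theorem offset_add_lt {E : List (List (ℕ × ℕ))} {r s : ℕ} (hr : r < E.length)
    (hs : s < (E.getD r []).length) : offset E r + s < E.flatten.length := by
  rw [List.getD_eq_getElem _ _ hr] at hs
  have : E.flatten.length = offset E r + (E.drop r).flatten.length := by
    rw [offset, ← List.length_append, ← List.flatten_append, List.take_append_drop]
  rw [List.drop_eq_getElem_cons hr, List.flatten_cons, List.length_append] at this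
  omega

theorem flatten_getElem?_offset_add {E : List (List (ℕ × ℕ))} {r s : ℕ} (hr : r < E.length)
    (hs : s < (E.getD r []).length) : E.flatten[offset E r + s]? = (E.getD r [])[s]? := by
  rw [List.getD_eq_getElem _ _ hr] at *
  have : E.flatten = (E.take r).flatten ++ (E[r] ++ (E.drop (r + 1)).flatten) := by
    rw [← List.flatten_cons, ← List.drop_eq_getElem_cons hr, ← List.flatten_append,
      List.take_append_drop]
  rw [this, offset, List.getElem?_append_right (by simp [-List.map_flatten, -List.length_flatten]), Nat.add_sub_cancel_left,
    List.getElem?_append_left hs]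

theorem prodSum_cases {E : List (List (ℕ × ℕ))} {t : ℕ} (ht : t < (prodSum E).length) :
    (∃ h : t < E.flatten.length, (prodSum E)[t] = .var E.flatten[t].1 E.flatten[t].2) ∨
    (∃ r < E.length, t = E.flatten.length + r ∧ (prodSum E)[t] = sumGate E r) ∨
    (∃ j < E.length - 1, t = E.flatten.length + (E.length + j) ∧ (prodSum E)[t] = prodGate E j) := by
  rw [length_prodSum] at ht
  rcases Nat.lt_or_ge t E.flatten.length with h₁ | h₁
  · refine Or.inl ⟨h₁, ?_⟩
    simp only [prodSum]
    rw [List.getElem_append_left (by simpa [-List.map_flatten, -List.length_flatten] using h₁)]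
    simp [-List.map_flatten, -List.length_flatten]
  · obtain ⟨r, rfl⟩ := Nat.exists_eq_add_of_le h₁
    rcases Nat.lt_or_ge r E.length with h₂ | h₂
    · refine Or.inr (Or.inl ⟨r, h₂, rfl, ?_⟩)
      simp only [prodSum]
      rw [List.getElem_append_right (by simp [-List.map_flatten, -List.length_flatten]),
          List.getElem_append_left (by simpa [-List.map_flatten, -List.length_flatten] using h₂)]
      simp [-List.map_flatten, -List.length_flatten]
    · obtain ⟨j, rfl⟩ := Nat.exists_eq_add_of_le h₂
      refine Or.inr (Or.inr ⟨j, by omega, rfl, ?_⟩)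
      simp only [prodSum]
      rw [List.getElem_append_right (by simp [-List.map_flatten, -List.length_flatten]),
          List.getElem_append_right (by simp [-List.map_flatten, -List.length_flatten])]
      simp [-List.map_flatten, -List.length_flatten]

theorem wellFormed_prodSum {E : List (List (ℕ × ℕ))} (hE : E ≠ []) (hne : ∀ l ∈ E, l ≠ [])
    (hlt : ∀ l ∈ E, ∀ e ∈ l, e.1 < e.2) : (prodSum E).WellFormed where
  nonempty h := by
    have := length_prodSum E
    have := List.length_pos_of_ne_nil hE
    simp [-List.map_flatten, -List.length_flatten, h] at *; omega
  proper g hg := by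
    obtain ⟨t, ht, rfl⟩ := List.getElem_of_mem hg
    rcases prodSum_cases ht with ⟨h, e⟩ | ⟨r, hr, _, e⟩ | ⟨j, _, _, e⟩
    · rw [e]
      obtain ⟨l, hl, hle⟩ := List.mem_flatten.1 (List.getElem_mem h)
      exact hlt l hl _ hle
    · rw [e, sumGate, ArithGate.Proper, List.getD_eq_getElem _ _ hr]
      simpa [-List.map_flatten, -List.length_flatten] using hne _ (List.getElem_mem hr)
    · rw [e]; trivial
  acyclic t ht a ha := by
    rcases prodSum_cases ht with ⟨h, e⟩ | ⟨r, hr, rfl, e⟩ | ⟨j, hj, rfl, e⟩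
    · simp [e, ArithGate.args] at ha
    · rw [e] at ha
      simp only [sumGate, ArithGate.args, List.mem_map, List.mem_range] at ha
      obtain ⟨s, hs, rfl⟩ := ha
      have := offset_add_lt hr hs
      omega
    · simp only [e, prodGate, ArithGate.args, List.mem_cons, List.not_mem_nil, or_false,
        decide_eq_true_eq] at ha
      rcases ha with rfl | rfl
      · split_ifs <;> omega
      · omega

section

variable (R : Type*) [CommSemiring R]

/-- The sum of the variables in a list. -/
noncomputable def sumX (l : List (ℕ × ℕ)) : MvPolynomial (ℕ × ℕ) R := (l.map X).sum

/-- By `eq_gateTable` it is enough that the proposed values satisfy the recursion of the table;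
`v₁`, `v₂`, `v₃` read its three blocks. -/
theorem gateTable_prodSum (E : List (List (ℕ × ℕ))) :
    gateTable (ArithGate.value R) (prodSum E) =
      E.flatten.map X ++ (E.map (sumX R) ++
        (List.range (E.length - 1)).map fun j => ((E.map (sumX R)).take (j + 2)).prod) := by
  set v : List (MvPolynomial (ℕ × ℕ) R) := E.flatten.map X ++ (E.map (sumX R) ++
        (List.range (E.length - 1)).map fun j => ((E.map (sumX R)).take (j + 2)).prod) with hv
  have v₁ : ∀ a, (h : a < E.flatten.length) → v.getD a 0 = X E.flatten[a] := by
    intro a h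
    rw [hv, List.getD_eq_getElem?_getD, List.getElem?_append_left (by simpa [-List.map_flatten, -List.length_flatten] using h)]
    simp [-List.map_flatten, -List.length_flatten, h]
  have v₂ : ∀ r, r < E.length → v.getD (E.flatten.length + r) 0 = sumX R (E.getD r []) := by
    intro r h
    rw [hv, List.getD_eq_getElem?_getD, List.getElem?_append_right (by simp [-List.map_flatten, -List.length_flatten]),
      List.getElem?_append_left (by simpa [-List.map_flatten, -List.length_flatten] using h)]
    simp [-List.map_flatten, -List.length_flatten, h]
  have v₃ : ∀ j, j < E.length - 1 → v.getD (E.flatten.length + (E.length + j)) 0 =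
      ((E.map (sumX R)).take (j + 2)).prod := by
    intro j h
    rw [hv, List.getD_eq_getElem?_getD, List.getElem?_append_right (by simp [-List.map_flatten, -List.length_flatten]),
      List.getElem?_append_right (by simp [-List.map_flatten, -List.length_flatten])]
    simp [-List.map_flatten, -List.length_flatten, h]
  have hl : v.length = (prodSum E).length := by rw [length_prodSum]; simp [-List.map_flatten, -List.length_flatten, hv]
  have hprod : ∀ r, r < E.length → ((E.map (sumX R)).take (r + 1)).prod =
      ((E.map (sumX R)).take r).prod * sumX R (E.getD r []) := by
    intro r hr
    rw [List.prod_take_succ _ _ (by simpa [-List.map_flatten, -List.length_flatten] using hr)]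
    simp [-List.map_flatten, -List.length_flatten, hr]
  refine eq_gateTable _ hl fun t ht => ?_
  have e₀ : v[t]'(hl ▸ ht) = v.getD t 0 := by rw [List.getD_eq_getElem]
  rw [e₀]
  rcases prodSum_cases ht with ⟨h, e⟩ | ⟨r, hr, rfl, e⟩ | ⟨j, hj, rfl, e⟩
  · rw [e, v₁ t h]; rfl
  · rw [e, v₂ r hr, sumGate, ArithGate.value, sumX, List.map_map]
    congr 1
    refine List.ext_getElem (by simp [-List.map_flatten, -List.length_flatten]) fun s h₁ h₂ => ?_
    have hs : s < (E.getD r []).length := by simpa [-List.map_flatten, -List.length_flatten] using h₁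
    have hlt := offset_add_lt hr hs
    simp only [List.getElem_map, List.getElem_range, Function.comp]
    rw [getD_take_of_lt _ (by omega), v₁ _ hlt]
    congr 1
    have := flatten_getElem?_offset_add hr hs
    rw [List.getElem?_eq_getElem hlt, List.getElem?_eq_getElem hs] at this
    exact (Option.some.inj this).symm
  · have h₁ : (v.take (E.flatten.length + (E.length + j))).getD (E.flatten.length + (j + 1)) 0 =
        sumX R (E.getD (j + 1) []) := by
      rw [getD_take_of_lt _ (by omega), v₂ _ (by omega)]
    rw [e, v₃ j hj, prodGate, ArithGate.value, h₁, hprod (j + 1) (by omega)]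
    congr 1
    -- The first product gate takes the first sum as its left factor; every later one takes the
    -- preceding product.
    rcases j with _ | j
    · simp only [decide_true, if_true]
      rw [getD_take_of_lt _ (by omega), ← add_zero E.flatten.length, v₂ 0 (by omega),
        hprod 0 (by omega)]
      simp [-List.map_flatten, -List.length_flatten]
    · simp only [Nat.add_eq_zero_iff, one_ne_zero, and_false, decide_false, Bool.false_eq_true,
        if_false, Nat.add_sub_cancel]
      rw [getD_take_of_lt _ (by omega), add_assoc E.flatten.length, v₃ j (by omega)]

theorem poly_prodSum {E : List (List (ℕ × ℕ))} (hE : E ≠ []) :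
    (prodSum E).poly R = (E.map (sumX R)).prod := by
  rw [poly, gateTable_prodSum, BoolCircuit.getLastD_eq_getD, List.getD_eq_getElem?_getD]
  have hpos := List.length_pos_of_ne_nil hE
  rw [List.getElem?_append_right (by simp [-List.map_flatten, -List.length_flatten]; omega)]
  rcases Nat.lt_or_ge 1 E.length with h | h
  · rw [List.getElem?_append_right (by simp [-List.map_flatten, -List.length_flatten]; omega),
      List.getElem?_map,
      List.getElem?_eq_getElem (by simp [-List.map_flatten, -List.length_flatten]; omega)]
    simp only [List.getElem_range, Option.map_some, Option.getD_some]
    rw [List.take_of_length_le (by simp [-List.map_flatten, -List.length_flatten]; omega)]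
  -- With a single list there is no product gate, and the output is its sum gate.
  · obtain ⟨l, rfl⟩ := List.length_eq_one_iff.1 (show E.length = 1 by omega)
    simp [-List.map_flatten, -List.length_flatten]

end

end ArithCircuit

/-! ### Clique monomials of products of sums of variables -/

/-- Expanding yields one monomial with coefficient one for each choice of a variable in every
factor; different choices may yield the same monomial. -/
theorem prod_sum_X_eq {R : Type*} [CommSemiring R] {ι σ : Type*} [DecidableEq ι] (P : Finset ι)
    (F : ι → Finset σ) : ∏ x ∈ P, ∑ e ∈ F x, (X e : MvPolynomial σ R) =
      ∑ p ∈ P.pi F, monomial (∑ x ∈ P.attach, Finsupp.single (p x.1 x.2) 1) 1 := by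
  rw [Finset.prod_sum]
  exact Finset.sum_congr rfl fun p _ => (monomial_sum_one _ _).symm

theorem sum_single_apply_ne_zero {ι σ : Type*} (s : Finset ι) (f : ι → σ) (e : σ) :
    (∑ x ∈ s, Finsupp.single (f x) 1 : σ →₀ ℕ) e ≠ 0 ↔ ∃ x ∈ s, f x = e := by
  classical
  rw [Finsupp.finsetSum_apply, ne_eq, Finset.sum_eq_zero_iff]
  simp [Finsupp.single_apply]

theorem cliqueMonomial_apply_ne_zero (S : Finset ℕ) (e : ℕ × ℕ) :
    cliqueMonomial S e ≠ 0 ↔ e.1 ∈ S ∧ e.2 ∈ S ∧ e.1 < e.2 := by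
  rw [cliqueMonomial, sum_single_apply_ne_zero]
  simp [and_assoc]

/-- The pairs of numbers `α < β` below `K`. -/
def pairsBelow (K : ℕ) : List (ℕ × ℕ) :=
  (List.range K).flatMap fun β => (List.range β).map fun α => (α, β)

theorem mem_pairsBelow {K : ℕ} {x : ℕ × ℕ} : x ∈ pairsBelow K ↔ x.1 < x.2 ∧ x.2 < K := by
  simp only [pairsBelow, List.mem_flatMap, List.mem_range, List.mem_map]
  constructor
  · rintro ⟨β, hβ, α, hα, rfl⟩; exact ⟨hα, hβ⟩
  · rintro ⟨h₁, h₂⟩; exact ⟨x.2, h₂, x.1, h₁, rfl⟩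

theorem nodup_pairsBelow (K : ℕ) : (pairsBelow K).Nodup := by
  rw [pairsBelow, List.nodup_flatMap]
  refine ⟨fun β _ => List.nodup_range.map fun a b h => (Prod.mk.inj h).1, ?_⟩
  refine List.nodup_range.imp fun {i j} hij => ?_
  simp only [Function.onFun, List.disjoint_left, List.mem_map]
  rintro _ ⟨a, _, rfl⟩ ⟨b, _, h⟩
  exact hij (Prod.mk.inj h).2.symm

theorem length_pairsBelow (K : ℕ) : (pairsBelow K).length = K * (K - 1) / 2 := by
  rw [← Finset.sum_range_id, pairsBelow, List.length_flatMap]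
  simp only [List.length_map, List.length_range]
  induction K with
  | zero => rfl
  | succ K ih => rw [List.sum_range_succ, ih, Finset.sum_range_succ]

/-- The number that stands for the `s`-th partial assignment in the list with index `α`. -/
def code (M α s : ℕ) : ℕ := 2 + (α * M + s)

/-- Each list owns a block of `M` consecutive numbers, and the blocks follow the order of the lists.
The shift by two reserves `0` and `1` for the additional variable. -/
theorem code_lt_code {M α β s s' : ℕ} (h : α < β) (hs : s < M) : code M α s < code M β s' := by
  have : (α + 1) * M ≤ β * M := Nat.mul_le_mul h le_rfl
  rw [add_mul, one_mul] at this
  simp only [code]; omega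

theorem code_inj {M α β s s' : ℕ} (hs : s < M) (hs' : s' < M) (h : code M α s = code M β s') :
    α = β ∧ s = s' := by
  rcases lt_trichotomy α β with hlt | rfl | hlt
  · have := code_lt_code (s' := s') hlt hs; omega
  · simp only [code] at h; omega
  · have := code_lt_code (s' := s) hlt hs'; omega

/-- The variables for compatible pairs from the lists with indices `x.1` and `x.2`, and an
additional variable. -/
def edgeVars (Ls : List (List (List (ℕ × ℕ)))) (x : ℕ × ℕ) : List (ℕ × ℕ) :=
  (0, 1) :: (List.range (Ls.getD x.1 []).length).flatMap fun s =>
    ((List.range (Ls.getD x.2 []).length).filter fun s' =>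
      compat ((Ls.getD x.1 []).getD s []) ((Ls.getD x.2 []).getD s' [])).map fun s' =>
        (code Ls.flatten.length x.1 s, code Ls.flatten.length x.2 s')

theorem lt_length_flatten {α : Type*} {Ls : List (List α)} {i s : ℕ}
    (h : s < (Ls.getD i []).length) : s < Ls.flatten.length := by
  refine h.trans_le ?_
  by_cases hi : i < Ls.length
  · rw [List.getD_eq_getElem _ _ hi]
    exact (List.sublist_flatten_of_mem (List.getElem_mem hi)).length_le
  · simp [hi]

theorem mem_edgeVars {Ls : List (List (List (ℕ × ℕ)))} {x e : ℕ × ℕ} : e ∈ edgeVars Ls x ↔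
    e = (0, 1) ∨ ∃ s < (Ls.getD x.1 []).length, ∃ s' < (Ls.getD x.2 []).length,
      compat ((Ls.getD x.1 []).getD s []) ((Ls.getD x.2 []).getD s' []) = true ∧
      e = (code Ls.flatten.length x.1 s, code Ls.flatten.length x.2 s') := by
  simp only [edgeVars, List.mem_cons, List.mem_flatMap, List.mem_range, List.mem_map,
    List.mem_filter, and_assoc, eq_comm (a := e)]

theorem nodup_edgeVars (Ls : List (List (List (ℕ × ℕ)))) (x : ℕ × ℕ) : (edgeVars Ls x).Nodup := by
  rw [edgeVars, List.nodup_cons]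
  constructor
  · simp [code]
  rw [List.nodup_flatMap]
  constructor
  · intro s _
    refine (List.nodup_range.filter _).map fun a b h => ?_
    have := (Prod.mk.inj h).2
    simp only [code] at this; omega
  · refine List.nodup_range.imp fun {i j} hij => ?_
    simp only [Function.onFun, List.disjoint_left, List.mem_map]
    rintro _ ⟨a, _, rfl⟩ ⟨b, _, h⟩
    have := (Prod.mk.inj h).1
    simp only [code] at this; omega

theorem lt_of_mem_edgeVars {Ls : List (List (List (ℕ × ℕ)))} {x e : ℕ × ℕ} (hx : x.1 < x.2)
    (he : e ∈ edgeVars Ls x) : e.1 < e.2 := by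
  rcases mem_edgeVars.1 he with rfl | ⟨s, hs, s', _, _, rfl⟩
  · simp
  · exact code_lt_code hx (lt_length_flatten hs)

/-! ### The polynomial of a choice problem and its clique monomials -/

section

variable (R : Type*) [CommSemiring R]

/-- The product over all pairs of lists of the sums of the variables for compatible choices. -/
noncomputable def choicePoly (Ls : List (List (List (ℕ × ℕ)))) : MvPolynomial (ℕ × ℕ) R :=
  ∏ x ∈ (pairsBelow Ls.length).toFinset, ∑ e ∈ (edgeVars Ls x).toFinset, X e

/-- Setting `x_{01}` to one and all other variables to zero makes each factor one. -/
theorem choicePoly_ne_zero [Nontrivial R] (Ls : List (List (List (ℕ × ℕ)))) :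
    choicePoly R Ls ≠ 0 := by
  intro h
  have := congrArg (eval fun e => if e = (0, 1) then (1 : R) else 0) h
  simp only [choicePoly, map_prod, map_sum, eval_X, map_zero] at this
  rw [Finset.prod_congr rfl (g := fun _ => 1) fun x _ => by
    rw [Finset.sum_ite_eq', if_pos (by simp [edgeVars])]] at this
  simp at this

/-- A nonzero product of linear forms, one for each pair of lists, is homogeneous of that degree. -/
theorem totalDegree_choicePoly [Nontrivial R] (Ls : List (List (List (ℕ × ℕ)))) :
    (choicePoly R Ls).totalDegree = Ls.length * (Ls.length - 1) / 2 := by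
  refine IsHomogeneous.totalDegree ?_ (choicePoly_ne_zero R Ls)
  have := IsHomogeneous.prod (pairsBelow Ls.length).toFinset
    (fun x => ∑ e ∈ (edgeVars Ls x).toFinset, (X e : MvPolynomial (ℕ × ℕ) R)) (fun _ => 1)
    fun x _ => IsHomogeneous.sum _ _ _ fun e _ => isHomogeneous_X R e
  rwa [Finset.sum_const, smul_eq_mul, mul_one,
    List.toFinset_card_of_nodup (nodup_pairsBelow _), length_pairsBelow] at this

variable {R} {Ls : List (List (List (ℕ × ℕ)))}

/-- The codes `u α` of the chosen entries form the clique. The two endpoints of a variable determine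
the factor it comes from, so exactly one term of the expansion gives the clique monomial, and its
coefficient is one. -/
theorem hasCliqueMonomial_of_choice [Nontrivial R] (h : HasCompatChoice Ls) :
    HasCliqueMonomial (choicePoly R Ls) Ls.length := by
  obtain ⟨c, hc, hcc⟩ := h
  have key : ∀ α < Ls.length, ∃ s < (Ls.getD α []).length, (Ls.getD α []).getD s [] = c α := by
    intro α hα
    obtain ⟨s, hs, h⟩ := List.getElem_of_mem (hc α hα)
    exact ⟨s, hs, by rw [List.getD_eq_getElem _ _ hs, h]⟩
  choose! s hs hsc using key
  set M := Ls.flatten.length with hM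
  set u : ℕ → ℕ := fun α => code M α (s α) with hu
  have hsM : ∀ α < Ls.length, s α < M := fun α hα => lt_length_flatten (hs α hα)
  have hmono : ∀ α β, α < β → β < Ls.length → u α < u β := fun α β h hβ =>
    code_lt_code h (hsM α (h.trans hβ))
  have hinj : ∀ α < Ls.length, ∀ β < Ls.length, u α = u β → α = β := fun α hα β hβ h =>
    (code_inj (hsM α hα) (hsM β hβ) h).1
  refine ⟨(Finset.range Ls.length).image u, ?_, ?_⟩
  · rw [Finset.card_image_of_injOn, Finset.card_range]
    intro α hα β hβ h
    exact hinj α (by simpa using hα) β (by simpa using hβ) h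
  set P := (pairsBelow Ls.length).toFinset with hP
  have hmemP : ∀ x, x ∈ P ↔ x.1 < x.2 ∧ x.2 < Ls.length := fun x => by
    rw [hP, List.mem_toFinset, mem_pairsBelow]
  have hmon : cliqueMonomial ((Finset.range Ls.length).image u) =
      ∑ x ∈ P, Finsupp.single (u x.1, u x.2) 1 := by
    rw [cliqueMonomial, ← Finset.sum_image (f := fun e : ℕ × ℕ => Finsupp.single e 1)
      (g := fun x : ℕ × ℕ => (u x.1, u x.2))]
    · congr 1
      ext ⟨a, b⟩
      simp only [Finset.mem_filter, Finset.mem_product, Finset.mem_image, Finset.mem_range,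
        Prod.mk.injEq]
      constructor
      · rintro ⟨⟨⟨α, hα, rfl⟩, ⟨β, hβ, rfl⟩⟩, hlt⟩
        refine ⟨(α, β), (hmemP _).2 ⟨?_, hβ⟩, rfl, rfl⟩
        by_contra hle
        rcases (not_lt.1 hle).lt_or_eq with h | h
        · have := hmono β α h hα
          omega
        · simp only at h
          subst h; omega
      · rintro ⟨x, hx, rfl, rfl⟩
        have hx := (hmemP x).1 hx
        exact ⟨⟨⟨_, hx.1.trans hx.2, rfl⟩, ⟨_, hx.2, rfl⟩⟩, hmono _ _ hx.1 hx.2⟩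
    · intro x hx y hy h
      have hx := (hmemP x).1 (by simpa using hx)
      have hy := (hmemP y).1 (by simpa using hy)
      obtain ⟨h₁, h₂⟩ := Prod.mk.inj h
      exact Prod.ext (hinj _ (hx.1.trans hx.2) _ (hy.1.trans hy.2) h₁) (hinj _ hx.2 _ hy.2 h₂)
  rw [hmon, choicePoly, prod_sum_X_eq, coeff_sum]
  rw [Finset.sum_eq_single fun x _ => (u x.1, u x.2)]
  · rw [coeff_monomial, if_pos]
    · exact one_ne_zero
    · exact Finset.sum_attach P fun x => Finsupp.single (u x.1, u x.2) 1
  · intro p hp hne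
    rw [coeff_monomial, if_neg]
    intro heq
    refine hne ?_
    funext x hx
    have hx' := (hmemP x).1 hx
    have h₁ : (∑ x ∈ P.attach, Finsupp.single (p x.1 x.2) 1 : ℕ × ℕ →₀ ℕ) (p x hx) ≠ 0 :=
      (sum_single_apply_ne_zero _ _ _).2 ⟨⟨x, hx⟩, Finset.mem_attach _ _, rfl⟩
    rw [heq, sum_single_apply_ne_zero] at h₁
    obtain ⟨y, hy, hyp⟩ := h₁
    have hy' := (hmemP y).1 hy
    have h₂ := Finset.mem_pi.1 hp x hx
    rw [List.mem_toFinset, mem_edgeVars, ← hyp] at h₂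
    -- Codes are at least two, which excludes `x_{01}`; otherwise they reveal the pair of lists.
    rcases h₂ with h₂ | ⟨a, ha, b, hb, _, h₂⟩
    · have := (Prod.mk.inj h₂).1
      simp only [hu, code] at this; omega
    · obtain ⟨e₁, e₂⟩ := Prod.mk.inj h₂
      have e₁ := (code_inj (hsM _ (hy'.1.trans hy'.2)) (lt_length_flatten ha) e₁).1
      have e₂ := (code_inj (hsM _ hy'.2) (lt_length_flatten hb) e₂).1
      rw [← hyp, e₁, e₂]
  · intro h
    refine absurd (Finset.mem_pi.2 fun x hx => ?_) h
    have hx' := (hmemP x).1 hx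
    rw [List.mem_toFinset, mem_edgeVars]
    refine Or.inr ⟨_, hs _ (hx'.1.trans hx'.2), _, hs _ hx'.2, ?_, rfl⟩
    rw [hsc _ (hx'.1.trans hx'.2), hsc _ hx'.2]
    exact hcc _ _ hx'.1 hx'.2

/-- Every edge of the clique is a variable of some factor, so the larger of two vertices belongs to
a later list. Hence the vertices lie in different lists, and as many vertices as lists leave no list
out. -/
theorem choice_of_hasCliqueMonomial (hK : 3 ≤ Ls.length)
    (h : HasCliqueMonomial (choicePoly R Ls) Ls.length) : HasCompatChoice Ls := by
  obtain ⟨S, hS, hcoeff⟩ := h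
  set M := Ls.flatten.length with hM
  rw [choicePoly, prod_sum_X_eq, coeff_sum] at hcoeff
  -- Some term of the expansion has the exponent vector of the clique.
  obtain ⟨p, hp, hne⟩ := Finset.exists_ne_zero_of_sum_ne_zero hcoeff
  rw [coeff_monomial] at hne
  have heq := (ite_ne_right_iff.1 hne).1
  have hedge : ∀ a ∈ S, ∀ b ∈ S, a < b →
      ∃ x : ℕ × ℕ, x.1 < x.2 ∧ x.2 < Ls.length ∧ (a, b) ∈ edgeVars Ls x := by
    intro a ha b hb hab
    have h₁ := (cliqueMonomial_apply_ne_zero S (a, b)).2 ⟨ha, hb, hab⟩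
    rw [← heq, sum_single_apply_ne_zero] at h₁
    obtain ⟨x, _, hx⟩ := h₁
    have h₂ := Finset.mem_pi.1 hp x.1 x.2
    rw [List.mem_toFinset, hx] at h₂
    have h₃ := mem_pairsBelow.1 (List.mem_toFinset.1 x.2)
    exact ⟨x.1, h₃.1, h₃.2, h₂⟩
  have hreal : ∀ a ∈ S, ∀ b ∈ S, a < b → ∃ α β s s', α < β ∧ β < Ls.length ∧
      s < (Ls.getD α []).length ∧ s' < (Ls.getD β []).length ∧
      compat ((Ls.getD α []).getD s []) ((Ls.getD β []).getD s' []) = true ∧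
      a = code M α s ∧ b = code M β s' := by
    intro a ha b hb hab
    obtain ⟨x, h₁, h₂, h₃⟩ := hedge a ha b hb hab
    rcases mem_edgeVars.1 h₃ with h | ⟨s, hs, s', hs', hc, h⟩
    · exfalso
      obtain ⟨rfl, rfl⟩ := Prod.mk.inj h
      -- If `x_{01}` occurred, a third vertex `w` would require a variable joining `0` and `w`, but
      -- `x_{01}` is the only one at `0`. This is where `3 ≤ Ls.length` is needed.
      obtain ⟨w, hw, hw'⟩ : ∃ w ∈ S, w ∉ ({0, 1} : Finset ℕ) :=
        Finset.exists_mem_notMem_of_card_lt_card (by rw [hS]; exact lt_of_lt_of_le (by simp) hK)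
      simp only [Finset.mem_insert, Finset.mem_singleton, not_or] at hw'
      obtain ⟨y, _, _, hy⟩ := hedge 0 ha w hw (by omega)
      rcases mem_edgeVars.1 hy with h | ⟨s, hs, s', hs', hc, h⟩
      · exact hw'.2 (Prod.mk.inj h).2
      · have := (Prod.mk.inj h).1
        simp only [code] at this; omega
    · obtain ⟨e₁, e₂⟩ := Prod.mk.inj h
      exact ⟨x.1, x.2, s, s', h₁, h₂, hs, hs', hc, e₁, e₂⟩
  have hvert : ∀ a ∈ S, ∃ α s, α < Ls.length ∧ s < (Ls.getD α []).length ∧ a = code M α s := by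
    intro a ha
    obtain ⟨b, hb, hne⟩ := Finset.exists_mem_ne (s := S) (by omega) a
    rcases lt_or_gt_of_ne hne with h | h
    · obtain ⟨α, β, s, s', h₁, h₂, h₃, h₄, h₅, h₆, h₇⟩ := hreal b hb a ha h
      exact ⟨β, s', h₂, h₄, h₇⟩
    · obtain ⟨α, β, s, s', h₁, h₂, h₃, h₄, h₅, h₆, h₇⟩ := hreal a ha b hb h
      exact ⟨α, s, h₁.trans h₂, h₃, h₆⟩
  choose! cls idx hcls hidx hcode using hvert
  have hcompat : ∀ a ∈ S, ∀ b ∈ S, a < b → cls a < cls b ∧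
      compat ((Ls.getD (cls a) []).getD (idx a) []) ((Ls.getD (cls b) []).getD (idx b) []) = true := by
    intro a ha b hb hab
    obtain ⟨α, β, s, s', h₁, h₂, h₃, h₄, h₅, h₆, h₇⟩ := hreal a ha b hb hab
    obtain ⟨e₁, e₂⟩ := code_inj (lt_length_flatten (hidx a ha)) (lt_length_flatten h₃)
      ((hcode a ha).symm.trans h₆)
    obtain ⟨e₃, e₄⟩ := code_inj (lt_length_flatten (hidx b hb)) (lt_length_flatten h₄)
      ((hcode b hb).symm.trans h₇)
    rw [e₁, e₂, e₃, e₄]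
    exact ⟨h₁, h₅⟩
  have hsurj : ∀ α < Ls.length, ∃ a ∈ S, cls a = α := by
    have := Finset.surjOn_of_injOn_of_card_le (s := S) (t := Finset.range Ls.length) cls
      (fun a ha => by simpa using hcls a ha) (fun a ha b hb hab => by
        by_contra hne
        rcases lt_or_gt_of_ne hne with h | h
        · have := (hcompat a ha b hb h).1; omega
        · have := (hcompat b hb a ha h).1; omega) (by simp [hS])
    intro α hα
    exact this (by simpa using hα)
  choose! u huS hu using hsurj
  refine ⟨fun α => (Ls.getD α []).getD (idx (u α)) [], fun α hα => ?_, fun α β h hβ => ?_⟩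
  · have := hidx (u α) (huS α hα)
    rw [hu α hα] at this
    simp only [List.getD_eq_getElem _ _ this]
    exact List.getElem_mem _
  · have hα := h.trans hβ
    have hlt : u α < u β := by
      rcases lt_trichotomy (u α) (u β) with h' | h' | h'
      · exact h'
      · have := congrArg cls h'
        rw [hu α hα, hu β hβ] at this; omega
      · have := (hcompat _ (huS β hβ) _ (huS α hα) h').1
        rw [hu α hα, hu β hβ] at this; omega
    have := (hcompat _ (huS α hα) _ (huS β hβ) hlt).2
    rwa [hu α hα, hu β hβ] at this

/-- The circuit for `choicePoly`. -/
def choiceCircuit (Ls : List (List (List (ℕ × ℕ)))) : ArithCircuit :=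
  ArithCircuit.prodSum ((pairsBelow Ls.length).map (edgeVars Ls))

theorem pairsBelow_ne_nil {K : ℕ} (hK : 3 ≤ K) : pairsBelow K ≠ [] := by
  refine List.ne_nil_of_mem (a := (0, 1)) (mem_pairsBelow.2 ⟨by simp, ?_⟩)
  show 1 < K
  omega

theorem poly_choiceCircuit (hK : 3 ≤ Ls.length) : (choiceCircuit Ls).poly R = choicePoly R Ls := by
  rw [choiceCircuit, ArithCircuit.poly_prodSum R (by simpa using pairsBelow_ne_nil hK),
    List.map_map, choicePoly, List.prod_toFinset _ (nodup_pairsBelow _)]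
  congr 2
  funext x
  rw [Function.comp, ArithCircuit.sumX, List.sum_toFinset _ (nodup_edgeVars _ _)]

variable (R) in
theorem representsCliqueDegree_choiceCircuit [Nontrivial R] (hK : 3 ≤ Ls.length) :
    RepresentsCliqueDegree R (choiceCircuit Ls) Ls.length := by
  refine ⟨ArithCircuit.wellFormed_prodSum (by simpa using pairsBelow_ne_nil hK) ?_ ?_, ?_, ?_⟩
  · intro l hl
    obtain ⟨x, _, rfl⟩ := List.mem_map.1 hl
    simp [edgeVars]
  · intro l hl e he
    obtain ⟨x, hx, rfl⟩ := List.mem_map.1 hl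
    exact lt_of_mem_edgeVars (mem_pairsBelow.1 hx).1 he
  · rw [poly_choiceCircuit hK]
    exact choicePoly_ne_zero R Ls
  · rw [poly_choiceCircuit hK]
    exact totalDegree_choicePoly R Ls

theorem hasCliqueMonomial_choiceCircuit_iff [Nontrivial R] (hK : 3 ≤ Ls.length) :
    HasCliqueMonomial ((choiceCircuit Ls).poly R) Ls.length ↔ HasCompatChoice Ls := by
  rw [poly_choiceCircuit hK]
  exact ⟨choice_of_hasCliqueMonomial hK, hasCliqueMonomial_of_choice⟩

end

/-! ### Polynomial time computability of the reduction -/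

section

variable {α β : Type*} [Enc α] [Enc β]

namespace Poly

theorem compat {c c' : α → List (ℕ × ℕ)} (hc : Poly c) (hc' : Poly c') :
    Poly (fun a => compat (c a) (c' a)) :=
  all (F := fun a (p : ℕ × ℕ) => (c' a).all fun r => !(decide (p.1 = r.1)) || decide (p.2 = r.2))
    (all (F := fun (p : α × ℕ × ℕ) (r : ℕ × ℕ) => !(decide (p.2.1 = r.1)) || decide (p.2.2 = r.2))
      (((fst.comp (snd.comp fst)).decide_eq (fst.comp snd)).not.or
        ((snd.comp (snd.comp fst)).decide_eq (snd.comp snd))) (hc'.comp fst)) hc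

theorem hits {A P : α → List (ℕ × ℕ)} (hA : Poly A) (hP : Poly P) :
    Poly (fun a => hits (A a) (P a)) :=
  any (F := fun a (p : ℕ × ℕ) => (A a).any fun r => decide (p.1 = r.1) && decide (p.2 = r.2))
    (any (F := fun (p : α × ℕ × ℕ) (r : ℕ × ℕ) => decide (p.2.1 = r.1) && decide (p.2.2 = r.2))
      (((fst.comp (snd.comp fst)).decide_eq (fst.comp snd)).and
        ((snd.comp (snd.comp fst)).decide_eq (snd.comp snd))) (hA.comp fst)) hP

theorem expand {H : α → List (List (ℕ × ℕ))} {A : α → List (ℕ × ℕ)} (hH : Poly H) (hA : Poly A) :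
    Poly (fun a => expand (H a) (A a)) := by
  have h : Poly (fun a => (H a).filter fun P => !(ParamComplexity.hits (A a) P)) :=
    filter (F := fun a P => !(ParamComplexity.hits (A a) P)) (hits (hA.comp fst) snd).not hH
  exact h.isEmpty.ite (hA.cons (const []))
    (map (F := fun a p => p :: A a) (snd.cons (hA.comp fst)) (h.headD (const [])))

theorem mem_searchLevel {H : List (List (ℕ × ℕ))} {N i : ℕ} {A : List (ℕ × ℕ)}
    (hA : A ∈ ParamComplexity.searchLevel H N i) : A.length ≤ i ∧ ∀ p ∈ A, ∃ P ∈ H, p ∈ P := by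
  induction i generalizing A with
  | zero => simp_all [ParamComplexity.searchLevel]
  | succ i ih =>
    rw [searchLevel_succ] at hA
    obtain ⟨A', hA', h⟩ := List.mem_flatMap.1 (List.mem_of_mem_take hA)
    obtain ⟨h₁, h₂⟩ := ih hA'
    rcases expand_cases H A' with ⟨e, _⟩ | ⟨P, hP, _, e⟩
    · rw [e, List.mem_singleton] at h
      subst h
      exact ⟨by omega, h₂⟩
    · rw [e] at h
      obtain ⟨p, hp, rfl⟩ := List.mem_map.1 h
      refine ⟨by simpa using h₁, fun r hr => ?_⟩
      rcases List.mem_cons.1 hr with rfl | hr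
      exacts [⟨P, hP, hp⟩, h₂ r hr]

/-- The cut-off bounds the number of nodes for every `H`, so the search is polynomial in `N` on all
inputs, without a bound on the branching. -/
theorem sz_searchLevel_le (H : List (List (ℕ × ℕ))) (N i : ℕ) :
    sz (ParamComplexity.searchLevel H N i) ≤ (N + 1) * (i * (sz H + 1) + 1 + 1) + 1 := by
  refine sz_list_le ?_ fun A hA => ?_
  · cases i with
    | zero => simp [ParamComplexity.searchLevel]
    | succ i =>
      rw [searchLevel_succ]
      exact (List.length_take_le _ _).trans (by omega)
  · obtain ⟨h₁, h₂⟩ := mem_searchLevel hA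
    refine sz_list_le h₁ fun p hp => ?_
    obtain ⟨P, hP, hpP⟩ := h₂ p hp
    exact (sz_le_of_mem hpP).trans (sz_le_of_mem hP)

theorem searchLevel {H : α → List (List (ℕ × ℕ))} {N m : α → ℕ} (hH : Poly H) (hN : Poly N)
    (hm : Poly m) : Poly (fun a => searchLevel (H a) (N a) (m a)) := by
  have key : Poly (fun c : List (List (ℕ × ℕ)) × ℕ × ℕ =>
      ParamComplexity.searchLevel c.1 c.2.1 c.2.2) := by
    refine iterate (step := fun (c : List (List (ℕ × ℕ)) × ℕ × ℕ) L =>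
        (L.flatMap (ParamComplexity.expand c.1)).take c.2.1) (take (fst.comp (snd.comp fst))
      (flatMap (F := fun (p : (List (List (ℕ × ℕ)) × ℕ × ℕ) × List (List (ℕ × ℕ))) A =>
        ParamComplexity.expand p.1.1 A) (expand (fst.comp (fst.comp fst)) snd) snd))
      (snd.comp snd) (const [[]])
      ((Polynomial.X + 1) * (Polynomial.X * (Polynomial.X + 1) + 1 + 1) + 1) fun c i hi => ?_
    have h₁ : sz c.1 ≤ sz c := by simp; omega
    have h₂ : c.2.1 ≤ sz c := by simp; omega
    have h₃ : i ≤ sz c := by simp; omega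
    simp only [Polynomial.eval_add, Polynomial.eval_mul, Polynomial.eval_X, Polynomial.eval_one]
    refine (sz_searchLevel_le c.1 c.2.1 i).trans ?_
    gcongr
  exact key.comp (hH.pair (hN.pair hm))

theorem hittingSets {H : α → List (List (ℕ × ℕ))} {N m : α → ℕ} (hH : Poly H) (hN : Poly N)
    (hm : Poly m) : Poly (fun a => hittingSets (H a) (N a) (m a)) :=
  filter (F := fun a A => (H a).all (ParamComplexity.hits A))
    (all (F := fun p P => ParamComplexity.hits p.2 P) (hits (snd.comp fst) snd) (hH.comp fst))
    (searchLevel hH hN hm)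

theorem tuples {n : α → ℕ} (q : ℕ) (hn : Poly n) : Poly (fun a => tuples (n a) q) := by
  induction q with
  | zero => exact const [[]]
  | succ q ih =>
    exact flatMap (F := fun a i => (ParamComplexity.tuples (n a) q).map fun I => i :: I)
      (map (F := fun p I => p.2 :: I) ((snd.comp fst).cons snd) (ih.comp fst)) hn.range

theorem graphOf {I U : α → List ℕ} (hI : Poly I) (hU : Poly U) :
    Poly (fun a => graphOf (I a) (U a)) :=
  map (F := fun a r => ((I a).getD r 0, (U a).getD r 0))
    (((hI.comp fst).getD snd (const 0)).pair ((hU.comp fst).getD snd (const 0))) hI.length.range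

section

variable {C : α → BoolCircuit} {k : α → ℕ}

theorem obstacles {w : α → List (ℕ × Bool)} {U : α → List ℕ} (d q : ℕ) (hC : Poly C) (hk : Poly k)
    (hw : Poly w) (hU : Poly U) :
    Poly (fun a => BoolCircuit.obstacles d q (C a) (k a) (w a) (U a)) :=
  map (F := fun a (p : ℕ × Bool) =>
      (((BoolCircuit.support d (C a) p.1).filter fun x => !(decide (x ∈ U a))).take q).flatMap
        fun x => (List.range (k a + 2)).map fun i => (i, x))
    (flatMap (F := fun p x => (List.range (k p.1 + 2)).map fun i => (i, x))
      (map (F := fun p i => (i, p.2)) (snd.pair (snd.comp fst))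
        ((hk.comp (fst.comp fst)).add (const 2)).range)
      (take (const q) (filter (F := fun p x => !(decide (x ∈ U p.1)))
        ((hU.comp (fst.comp fst)).contains snd).not
        (support d (hC.comp fst) (fst.comp snd)))))
    (filter (F := fun a (p : ℕ × Bool) => !(BoolCircuit.evalAt d (C a) (U a) p.1 == p.2))
      ((evalAt d (hC.comp fst) (hU.comp fst) (fst.comp snd)).beq_bool (snd.comp snd)).not hw)

theorem legal {p : α → ℕ × ℕ} (hC : Poly C) (hk : Poly k) (hp : Poly p) :
    Poly (fun a => (C a).legal (k a) (p a)) :=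
  ((fst.comp hp).decide_lt hk).ite
    (((snd.comp hp).decide_lt hC.length).and ((hC.gate (snd.comp hp)).tag.decide_eq (const 0)))
    ((snd.comp hp).decide_eq (hC.length.add (fst.comp hp)))

theorem valid {z : α → List (ℕ × ℕ)} (hC : Poly C) (hk : Poly k) (hz : Poly z) :
    Poly (fun a => (C a).valid (k a) (z a)) :=
  (all (F := fun a p => (C a).legal (k a) p) (legal (hC.comp fst) (hk.comp fst) snd) hz).and
    (all (F := fun a p => (z a).all fun r => !(decide (p.2 = r.2)) || decide (p.1 = r.1))
      (all (F := fun (p : α × ℕ × ℕ) (r : ℕ × ℕ) => !(decide (p.2.2 = r.2)) || decide (p.2.1 = r.1))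
        (((snd.comp (snd.comp fst)).decide_eq (snd.comp snd)).not.or
          ((fst.comp (snd.comp fst)).decide_eq (fst.comp snd))) (hz.comp fst)) hz)

theorem contents {N : α → ℕ} {I : α → List ℕ} (d q : ℕ) (hC : Poly C) (hk : Poly k) (hN : Poly N)
    (hI : Poly I) : Poly (fun a => BoolCircuit.contents d q (C a) (k a) (N a) (I a)) := by
  have hW : Poly (fun a => BoolCircuit.alts d (C a) ((C a).length - 1) true) :=
    alts d hC (hC.length.sub (const 1)) (const true)
  have hG : Poly (fun p : (α × ℕ) × List ℕ => ParamComplexity.graphOf (I p.1.1) p.2) :=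
    graphOf (hI.comp (fst.comp fst)) snd
  have hk' : Poly (fun a => k a + 2) := hk.add (const 2)
  have hH : Poly (fun p : (α × ℕ) × List ℕ => ParamComplexity.hittingSets
      (BoolCircuit.obstacles d q (C p.1.1) (k p.1.1)
        ((BoolCircuit.alts d (C p.1.1) ((C p.1.1).length - 1) true).getD p.1.2 []) p.2)
      (N p.1.1) (k p.1.1 + 2)) :=
    hittingSets (obstacles d q (hC.comp (fst.comp fst)) (hk.comp (fst.comp fst))
      ((hW.comp (fst.comp fst)).getD (snd.comp fst) (const [])) snd) (hN.comp (fst.comp fst))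
      (hk'.comp (fst.comp fst))
  have hM := map (F := fun (p : (α × ℕ) × List ℕ) A =>
    (k p.1.1 + 2, p.1.2) :: (ParamComplexity.graphOf (I p.1.1) p.2 ++ A))
    (((hk'.comp (fst.comp (fst.comp fst))).pair (snd.comp (fst.comp fst))).cons
      ((hG.comp fst).append snd)) hH
  have hF := filter (F := fun (_ : (α × ℕ) × List ℕ) c => ParamComplexity.compat c c)
    (compat snd snd) hM
  have hV : Poly (fun p : (α × ℕ) × List ℕ =>
      (C p.1.1).valid (k p.1.1) (ParamComplexity.graphOf (I p.1.1) p.2)) :=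
    valid (hC.comp (fst.comp fst)) (hk.comp (fst.comp fst)) hG
  have hT : Poly (fun p : α × ℕ => ParamComplexity.tuples ((C p.1).length + (k p.1 + 2)) q) :=
    tuples q ((hC.length.add hk').comp fst)
  exact flatMap (flatMap (hV.ite hF (const [])) hT) hW.length.range

theorem choiceLists {N : α → ℕ} (d q : ℕ) (hC : Poly C) (hk : Poly k) (hN : Poly N) :
    Poly (fun a => BoolCircuit.choiceLists d q (C a) (k a) (N a)) :=
  map (F := fun a I => BoolCircuit.contents d q (C a) (k a) (N a) I)
    (contents d q (hC.comp fst) (hk.comp fst) (hN.comp fst) snd) (tuples q (hk.add (const 2)))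

end

theorem pairsBelow {n : α → ℕ} (hn : Poly n) : Poly (fun a => pairsBelow (n a)) :=
  flatMap (F := fun _ j => (List.range j).map fun i => (i, j))
    (map (F := fun p i => (i, p.2)) (snd.pair (snd.comp fst)) snd.range) hn.range

theorem code {M i s : α → ℕ} (hM : Poly M) (hi : Poly i) (hs : Poly s) :
    Poly (fun a => code (M a) (i a) (s a)) :=
  (const 2).add ((hi.mul hM).add hs)

theorem edgeVars {Ls : α → List (List (List (ℕ × ℕ)))} {x : α → ℕ × ℕ} (hL : Poly Ls)
    (hx : Poly x) : Poly (fun a => edgeVars (Ls a) (x a)) := by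
  have h₁ : Poly (fun a => (Ls a).getD (x a).1 []) := hL.getD (fst.comp hx) (const [])
  have h₂ : Poly (fun a => (Ls a).getD (x a).2 []) := hL.getD (snd.comp hx) (const [])
  have hM : Poly (fun a => (Ls a).flatten.length) := hL.flatten.length
  exact (const (0, 1)).cons (flatMap (F := fun a s =>
      ((List.range ((Ls a).getD (x a).2 []).length).filter fun s' => ParamComplexity.compat
        (((Ls a).getD (x a).1 []).getD s []) (((Ls a).getD (x a).2 []).getD s' [])).map fun s' =>
        (ParamComplexity.code (Ls a).flatten.length (x a).1 s,
          ParamComplexity.code (Ls a).flatten.length (x a).2 s'))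
    (map (F := fun p s' => (ParamComplexity.code (Ls p.1).flatten.length (x p.1).1 p.2,
        ParamComplexity.code (Ls p.1).flatten.length (x p.1).2 s'))
      ((code (hM.comp (fst.comp fst)) ((fst.comp hx).comp (fst.comp fst)) (snd.comp fst)).pair
        (code (hM.comp (fst.comp fst)) ((snd.comp hx).comp (fst.comp fst)) snd))
      (filter (F := fun p s' => ParamComplexity.compat
          (((Ls p.1).getD (x p.1).1 []).getD p.2 []) (((Ls p.1).getD (x p.1).2 []).getD s' []))
        (compat ((h₁.comp (fst.comp fst)).getD (snd.comp fst) (const []))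
          ((h₂.comp (fst.comp fst)).getD snd (const []))) (h₂.length.comp fst).range))
    h₁.length.range)

theorem congr_enc {γ : Type*} [Enc γ] {f : α → β} {g : α → γ} (hg : Poly g)
    (h : ∀ a, enc (f a) = enc (g a)) : Poly f := by
  obtain ⟨p, P, hp⟩ := hg
  exact ⟨p, P, fun a => h a ▸ hp a⟩

theorem varGate {i j : α → ℕ} (hi : Poly i) (hj : Poly j) :
    Poly (fun a => ArithGate.var (i a) (j a)) :=
  congr_enc ((const 0).pair (hi.pair hj)) fun _ => rfl

theorem addGate {l : α → List ℕ} (hl : Poly l) : Poly (fun a => ArithGate.add (l a)) :=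
  congr_enc ((const 1).pair hl) fun _ => rfl

theorem mulGate {i j : α → ℕ} (hi : Poly i) (hj : Poly j) :
    Poly (fun a => ArithGate.mul (i a) (j a)) :=
  congr_enc ((const 2).pair (hi.pair hj)) fun _ => rfl

theorem prodSum {E : α → List (List (ℕ × ℕ))} (hE : Poly E) :
    Poly (fun a => ArithCircuit.prodSum (E a)) := by
  have h₁ : Poly (fun a => (E a).flatten.map fun e => ArithGate.var e.1 e.2) :=
    map (F := fun _ (e : ℕ × ℕ) => ArithGate.var e.1 e.2) (varGate (fst.comp snd) (snd.comp snd))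
      hE.flatten
  have h₂ : Poly (fun a => (List.range (E a).length).map (ArithCircuit.sumGate (E a))) :=
    map (F := fun a r => ArithCircuit.sumGate (E a) r)
      (addGate (map (F := fun (p : α × ℕ) s => ArithCircuit.offset (E p.1) p.2 + s)
        ((((snd.comp fst).take (hE.comp (fst.comp fst))).flatten.length).add snd)
        ((hE.comp fst).getD snd (const [])).length.range)) hE.length.range
  have h₃ : Poly (fun a => (List.range ((E a).length - 1)).map (ArithCircuit.prodGate (E a))) := by
    have hV : Poly (fun p : α × ℕ => (E p.1).flatten.length) := (hE.comp fst).flatten.length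
    have hm : Poly (fun p : α × ℕ => (E p.1).length) := (hE.comp fst).length
    exact map (F := fun a j => ArithCircuit.prodGate (E a) j)
      (mulGate ((snd.decide_eq (const 0)).ite hV ((hV.add hm).add (snd.sub (const 1))))
        (hV.add (snd.add (const 1)))) (hE.length.sub (const 1)).range
  exact h₁.append (h₂.append h₃)

theorem choiceCircuit {Ls : α → List (List (List (ℕ × ℕ)))} (hL : Poly Ls) :
    Poly (fun a => choiceCircuit (Ls a)) :=
  prodSum (map (F := fun a x => ParamComplexity.edgeVars (Ls a) x) (edgeVars (hL.comp fst) snd)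
    hL.length.pairsBelow)

/-- The reduction, given a bound `p.2` for the number of hitting sets. -/
theorem reduction (d q : ℕ) : Poly (fun p : (BoolCircuit × ℕ) × ℕ =>
    (ParamComplexity.choiceCircuit (BoolCircuit.choiceLists d q p.1.1 p.1.2 p.2),
      (BoolCircuit.choiceLists d q p.1.1 p.1.2 p.2).length)) := by
  have h : Poly (fun p : (BoolCircuit × ℕ) × ℕ =>
      BoolCircuit.choiceLists d q p.1.1 p.1.2 p.2) :=
    choiceLists d q (fst.comp fst) (snd.comp fst) snd
  exact h.choiceCircuit.pair h.length

end Poly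

end

/-! ### Powers of two -/

/-- Powers of two are computed in time polynomial in the value. -/
theorem exists_runs_two_pow : ∃ (p : Prog) (Q : Polynomial ℕ), ∀ n : ℕ,
    ∃ t, Runs p (enc n) (enc (2 ^ n)) t ∧ t ≤ Q.eval (2 ^ n) := by
  obtain ⟨p, P, hp⟩ : Poly (fun x : Unit × ℕ × Unit => x.2.1 + x.2.1) :=
    (Poly.fst.comp Poly.snd).add (Poly.fst.comp Poly.snd)
  have e : ∀ (l : List Unit) (s : ℕ), l.foldl (fun s _ => s + s) s = 2 ^ l.length * s := by
    intro l
    induction l with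
    | nil => simp
    | cons a l ih => intro s; simp only [List.foldl_cons, ih, List.length_cons]; ring
  obtain ⟨q, Q, hq⟩ : Poly (fun n : ℕ => ((), List.replicate n (), 1)) :=
    (Poly.const ()).pair (Poly.id.replicate_unit.pair (Poly.const 1))
  obtain ⟨r, S, hr⟩ : Poly (fun x : Unit × List Unit × ℕ => x.2.2) := Poly.snd.comp Poly.snd
  -- At `2 ^ n` this exceeds all the sizes at which the time bounds are evaluated.
  let Y : Polynomial ℕ := 20 * Polynomial.X
  refine ⟨.comp r (.comp (Prog.fold p) q), Q.comp Y + Y * (P.comp Y + 20 * Y) + S.comp Y + 2,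
    fun n => ?_⟩
  obtain ⟨t₁, h₁, h₁'⟩ := hq n
  obtain ⟨t₂, h₂, h₂'⟩ := Runs.fold (step := fun (_ : Unit) (s : ℕ) (_ : Unit) => s + s)
    (fun c s a => hp (c, s, a)) () (List.replicate n ()) 1 (2 * 2 ^ n + 1) (by
      intro l₁ l₂ h
      have hl := congrArg List.length h
      simp only [List.length_replicate, List.length_append] at hl
      have : 2 ^ l₁.length ≤ 2 ^ n := Nat.pow_le_pow_right (by omega) (by omega)
      simp only [e, sz_nat]
      omega)
  obtain ⟨t₃, h₃, h₃'⟩ := hr ((), [], 2 ^ n)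
  rw [e, List.length_replicate, mul_one] at h₂
  refine ⟨_, Runs.comp (Runs.comp h₁ h₂) h₃, ?_⟩
  have hn : n < 2 ^ n := Nat.lt_two_pow_self
  have hs : sz (List.replicate n ()) = 2 * n + 1 := by
    rw [← sz_nat, sz, sz, Poly.enc_replicate_unit]
  have hY : Y.eval (2 ^ n) = 20 * 2 ^ n := by simp [Y]
  simp only [Polynomial.eval_add, Polynomial.eval_mul, Polynomial.eval_comp, Polynomial.eval_ofNat,
    hY]
  rw [hs, sz_unit] at h₂'
  have a₁ := h₁'.trans (eval_mono Q (show sz n ≤ 20 * 2 ^ n by rw [sz_nat]; omega))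
  have a₃ := h₃'.trans (eval_mono S (show sz ((), ([] : List Unit), 2 ^ n) ≤ 20 * 2 ^ n by
    simp; omega))
  have hle : 1 + (2 * n + 1) + (2 * 2 ^ n + 1) + 2 ≤ 20 * 2 ^ n := by omega
  have a₂ : t₂ ≤ 20 * 2 ^ n * (P.eval (20 * 2 ^ n) + 20 * (20 * 2 ^ n)) := by
    refine h₂'.trans (Nat.mul_le_mul (by omega) ?_)
    have := eval_mono P hle
    omega
  omega

/-! ### The reduction -/

/-- `P.eval 1` is the sum of the coefficients. This form lets the bound be split into a factor
depending on `k` and a power of the input size. -/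
theorem eval_le_mul_pow (P : Polynomial ℕ) {n : ℕ} (hn : 1 ≤ n) :
    P.eval n ≤ P.eval 1 * n ^ P.natDegree := by
  rw [Polynomial.eval_eq_sum_range, Polynomial.eval_eq_sum_range, Finset.sum_mul]
  refine Finset.sum_le_sum fun i hi => ?_
  rw [one_pow, mul_one]
  have : i ≤ P.natDegree := by
    have := Finset.mem_range.1 hi; omega
  gcongr

/-- The reduction from weighted satisfiability, with its running time. -/
theorem exists_runs_reduction (d q : ℕ) : ∃ (p : Prog) (a b : ℕ), ∀ (C : BoolCircuit) (k : ℕ),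
    ∃ N t, N = 2 ^ (q * (k + 2) * (k + 2)) ∧
      Runs p (enc (C, k)) (enc (choiceCircuit (C.choiceLists d q k N),
        (C.choiceLists d q k N).length)) t ∧
      t ≤ a * (8 * (2 ^ (q * (k + 2) * (k + 2)) + k)) ^ b * sz C ^ b := by
  obtain ⟨p₁, P₁, h₁⟩ : Poly (fun x : BoolCircuit × ℕ => q * (x.2 + 2) * (x.2 + 2)) :=
    ((Poly.const q).mul (Poly.snd.add (Poly.const 2))).mul (Poly.snd.add (Poly.const 2))
  obtain ⟨p₂, P₂, h₂⟩ := exists_runs_two_pow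
  obtain ⟨p₃, P₃, h₃⟩ := Poly.reduction d q
  let P := Polynomial.X + P₁ + P₂ + P₃ + 3
  refine ⟨.comp p₃ (.cons .id (.comp p₂ p₁)), P.eval 1, P.natDegree, fun C k => ?_⟩
  set N := 2 ^ (q * (k + 2) * (k + 2)) with hN
  obtain ⟨t₁, r₁, le₁⟩ := h₁ (C, k)
  obtain ⟨t₂, r₂, le₂⟩ := h₂ (q * (k + 2) * (k + 2))
  obtain ⟨t₃, r₃, le₃⟩ := h₃ ((C, k), N)
  refine ⟨N, _, rfl, Runs.comp (Runs.cons (Runs.id _) (Runs.comp r₁ r₂)) r₃, ?_⟩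
  have hC := one_le_sz C
  have hN₁ : 1 ≤ N := Nat.one_le_two_pow
  -- A common bound for the inputs of the three programs, already a product of a function of `k` and
  -- the size of the circuit.
  set Z := 8 * (N + k) * sz C with hZ
  have hZ₁ : sz ((C, k), N) ≤ Z := by
    simp only [sz_prod, sz_nat, hZ]
    nlinarith
  have hZ₂ : sz (C, k) ≤ Z := by simp at *; omega
  have hZ₃ : N ≤ Z := by simp at *; omega
  rw [mul_assoc, ← mul_pow, ← hZ]
  refine le_trans ?_ (eval_le_mul_pow P (hN₁.trans hZ₃))
  have e₁ := le₁.trans (eval_mono P₁ hZ₂)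
  have e₂ := le₂.trans (eval_mono P₂ hZ₃)
  have e₃ := le₃.trans (eval_mono P₃ hZ₁)
  have e₀ : (enc (C, k)).size ≤ Z := hZ₂
  simp only [P, Polynomial.eval_add, Polynomial.eval_X, Polynomial.eval_ofNat]
  omega

/-! ### Injectivity of the encodings, and computability of the bounds -/

theorem BoolGate.encode_injective : Function.Injective BoolGate.encode := by
  have h : Function.Injective (fun l : List ℕ => Data.list (l.map .num)) :=
    Data.list_injective.comp (List.map_injective_iff.2 Data.num_injective)
  intro G G' e
  cases G <;> cases G' <;> simp only [encode, Data.num, Data.cons.injEq, reduceCtorEq, false_and,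
    and_false, true_and] at e
  · rfl
  · rw [Data.num_injective e]
  · rw [h e]
  · rw [h e]

/-- Yes-instances are given by the existence of a circuit with the given code; injectivity
identifies it with the circuit at hand. -/
theorem BoolCircuit.encode_injective : Function.Injective BoolCircuit.encode :=
  Data.list_injective.comp (List.map_injective_iff.2 BoolGate.encode_injective)

theorem ArithGate.encode_injective : Function.Injective ArithGate.encode := by
  have h : Function.Injective (fun l : List ℕ => Data.list (l.map .num)) :=
    Data.list_injective.comp (List.map_injective_iff.2 Data.num_injective)
  intro G G' e
  cases G <;> cases G' <;> simp only [encode, Data.num, Data.cons.injEq, reduceCtorEq, false_and,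
    and_false, true_and] at e
  · rw [Data.num_injective e.1, Data.num_injective e.2]
  · rw [h e]
  · rw [Data.num_injective e.1, Data.num_injective e.2]

theorem ArithCircuit.encode_injective : Function.Injective ArithCircuit.encode :=
  Data.list_injective.comp (List.map_injective_iff.2 ArithGate.encode_injective)

theorem computable_pow {f g : ℕ → ℕ} (hf : Computable f) (hg : Computable g) :
    Computable fun n => f n ^ g n :=
  (Primrec₂.unpaired'.1 Nat.Primrec.pow).to_comp.comp hf hg

theorem computable_mul {f g : ℕ → ℕ} (hf : Computable f) (hg : Computable g) :
    Computable fun n => f n * g n :=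
  Primrec.nat_mul.to_comp.comp hf hg

theorem computable_add {f g : ℕ → ℕ} (hf : Computable f) (hg : Computable g) :
    Computable fun n => f n + g n :=
  Primrec.nat_add.to_comp.comp hf hg

end ParamComplexity

/-! ### The hardness theorem -/

open ParamComplexity in
theorem mainTheorem5 (R : Type*) [CommSemiring R] [Nontrivial R] :
    ParamComplexity.W1Hard (ParamComplexity.cliqueMonomialTesting R) := by
  rintro A ⟨d, p, f, g, c, hf, hg, hA⟩
  obtain ⟨q, hq, hqd⟩ : ∃ q, 2 ≤ q ∧ 2 ^ d ≤ q :=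
    ⟨2 ^ d + 2, Nat.le_add_left _ _, Nat.le_add_right _ _⟩
  obtain ⟨r, a, b, hr⟩ := exists_runs_reduction d q
  set F : ℕ → ℕ := fun k => a * (8 * (2 ^ (q * (k + 2) * (k + 2)) + k)) ^ b with hF
  have hFmono : Monotone F := fun k l h => by simp only [hF]; gcongr; norm_num
  have hFcomp : Computable F := by
    -- `F` is the dependence on the parameter in `exists_runs_reduction`; monotonicity lets it be
    -- taken at `g k` instead of `k'`.
    have h₂ : Computable fun k : ℕ => k + 2 := computable_add .id (.const 2)
    exact computable_mul (.const a) (computable_pow (computable_mul (.const 8) (computable_add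
      (computable_pow (.const 2) (computable_mul (computable_mul (.const q) h₂) h₂)) .id))
      (.const b))
  -- The intermediate circuit is no larger than the time `f k * x.size ^ c` of the first reduction,
  -- and the second raises this to the power `b`; the exponent `c + c * b` covers both runs, and the
  -- summand one pays for the composition. The new parameter is the number of `q`-tuples.
  refine ⟨.comp r p, fun k => f k + F (g k) * f k ^ b + 1, fun k => (g k + 2) ^ q, c + c * b,
    computable_add (computable_add hf (computable_mul (hFcomp.comp hg)
      (computable_pow hf (.const b)))) (.const 1),
    computable_pow (computable_add hg (.const 2)) (.const q), fun x k hx => ?_⟩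
  obtain ⟨x', k', t, hrun, ht, hk', ⟨C, hC, hw, hd, hCx⟩, hyes⟩ := hA x k hx
  obtain rfl : x' = C.encode := hCx
  obtain ⟨N, s, hN, hrun', hs⟩ := hr C k'
  set Ls := C.choiceLists d q k' N with hLs
  have hlen : Ls.length = (k' + 2) ^ q := by
    rw [hLs, BoolCircuit.choiceLists, List.length_map, length_tuples]
  have hK : 3 ≤ Ls.length := by
    have h₁ : 2 ^ 2 ≤ 2 ^ q := Nat.pow_le_pow_right (by omega) hq
    have h₂ : 2 ^ q ≤ (k' + 2) ^ q := Nat.pow_le_pow_left (by omega) q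
    omega
  -- By `m < 2 ^ m`, a power of two is large enough to bound the leaves of the search tree.
  have hNle : (q * (k' + 2)) ^ (k' + 2) ≤ N := by
    rw [hN, pow_mul]
    exact Nat.pow_le_pow_left Nat.lt_two_pow_self.le _
  have hsat : HasCliqueMonomial ((choiceCircuit Ls).poly R) Ls.length ↔ C.WeightedSat k' := by
    rw [hasCliqueMonomial_choiceCircuit_iff hK, hLs]
    exact hC.hasCompatChoice_iff hw hd hq hqd hNle
  have hrep := representsCliqueDegree_choiceCircuit R hK
  refine ⟨(choiceCircuit Ls).encode, Ls.length, _, Runs.comp hrun hrun', ?_, ?_,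
    ⟨_, hrep, rfl⟩, ?_⟩
  · have hsz : sz C ≤ t := by
      have h₁ := hrun.size_le
      have h₂ : sz C = C.encode.size := rfl
      simp only [Data.size] at h₁
      omega
    have hx₁ : 1 ≤ x.size := x.one_le_size
    have e₁ : s ≤ F (g k) * (f k * x.size ^ c) ^ b := by
      refine hs.trans ?_
      gcongr
      · exact hFmono hk'
      · exact hsz.trans ht
    have e₂ : f k * x.size ^ c ≤ f k * x.size ^ (c + c * b) :=
      Nat.mul_le_mul le_rfl (Nat.pow_le_pow_right hx₁ (Nat.le_add_right _ _))
    have e₃ : F (g k) * (f k * x.size ^ c) ^ b ≤ F (g k) * f k ^ b * x.size ^ (c + c * b) := by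
      rw [mul_pow, ← pow_mul, ← mul_assoc]
      exact Nat.mul_le_mul le_rfl (Nat.pow_le_pow_right hx₁ (Nat.le_add_left _ _))
    have e₄ : 1 ≤ x.size ^ (c + c * b) := Nat.one_le_pow _ _ hx₁
    calc t + s + 1 ≤ f k * x.size ^ (c + c * b) + F (g k) * f k ^ b * x.size ^ (c + c * b) +
          x.size ^ (c + c * b) := by omega
      _ = (f k + F (g k) * f k ^ b + 1) * x.size ^ (c + c * b) := by ring
  · rw [hlen]
    exact Nat.pow_le_pow_left (by omega) q
  · rw [hyes]
    constructor
    · rintro ⟨C', _, _, _, hC', hsat'⟩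
      obtain rfl := BoolCircuit.encode_injective hC'
      exact ⟨_, hrep, rfl, hsat.2 hsat'⟩
    · rintro ⟨D, _, hD, hmon⟩
      obtain rfl := ArithCircuit.encode_injective hD
      exact ⟨C, hC, hw, hd, rfl, hsat.1 hmon⟩
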